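/- Let $X$ be a (finite-dimensional, Hausdorff) complex manifold with associated almost complex structure $J:TX\to TX$, and let $J^*\alpha=\alpha\circ J$ be the dual map on $T^*X$. Let $\pi\in\Gamma(\wedge^2 T_{\mathbb C}X)$ be a smooth complex bivector field and write $\pi=\pi_R+i\pi_I$ with $\pi_R,\pi_I\in\Gamma(\wedge^2TX)$ real bivector fields. For a real bivector field $P$ let $P^\sharp:T^*X\to TX$ be the map with $\langle\beta,P^\sharp\alpha\rangle=P(\alpha,\beta)$. Then the following are equivalent: (a) $\pi$ is a holomorphic Poisson bivector field, i.e. $\pi\in\Gamma(\wedge^2T^{1,0}X)$, $\bar\partial\pi=0$ and the Schouten bracket $[\pi,\pi]$ vanishes; (b) $(\pi_I,J)$ is a Poisson–Nijenhuis structure on $X$ and $\pi_R^\sharp=\pi_I^\sharp\circ J^*$; (c) the endomorphism $$\mathcal J_\pi=\begin{pmatrix}J&\pi_I^\sharp\\0&-J^*\end{pmatrix}$$ of $TX\oplus T^*X$ is a generalized complex structure and $\pi_R^\sharp=\pi_I^\sharp\circ J^*$. Here a Poisson–Nijenhuis structure is a pair $(P,N)$ of a real bivector field $P$ with $[P,P]=0$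 and a smooth $(1,1)$-tensor $N$ with vanishing Nijenhuis torsion, $[NV,NW]-N([NV,W]+[V,NW]-N[V,W])=0$ for all vector fields $V,W$, such that $N\circ P^\sharp=P^\sharp\circ N^*$ and $$[\alpha,\beta]_{P_N}=[N^*\alpha,\beta]_P+[\alpha,N^*\beta]_P-N^*[\alpha,\beta]_P$$ for all one-forms $\alpha,\beta$, where $P_N^\sharp=P^\sharp\circ N^*$ and $[\alpha,\beta]_{P}=L_{P^\sharp\alpha}\beta-L_{P^\sharp\beta}\alpha-d(P(\alpha,\beta))$ (and likewise for $P_N$). A generalized complex structure is a smooth endomorphism $\mathcal J$ of $TX\oplus T^*X$ with $\mathcal J^2=-1$, orthogonal for the pairing $\langle V+\alpha,W+\beta\rangle=\tfrac12(\alpha(W)+\beta(V))$, whose Nijenhuis torsion with respect to the Courant bracket $[V+\alpha,W+\beta]=[V,W]+L_V\beta-L_W\alpha+\tfrac12d(\alpha(W)-\beta(V))$ vanishes. -/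

import Mathlib

open scoped Manifold ContDiff

noncomputable section

namespace HolPoisson

/-! ### Tensor calculus on a real manifold -/

section Real

variable {E : Type*} [NormedAddCommGroup E] [NormedSpace ℝ E]
  {M : Type*} [TopologicalSpace M] [ChartedSpace E M]

/-- The real tangent space `T_x M`. -/
abbrev Tan (x : M) : Type _ := TangentSpace 𝓘(ℝ, E) x

/-- Real-linear covectors on `T_x M` with values in `𝕜`. For `𝕜 = ℝ` this is `T_x^* M`, for `𝕜 = ℂ`
it is the complexified cotangent space `T_x^* M ⊗ ℂ`. -/
abbrev Cotan (𝕜 : Type*) [NormedField 𝕜] [NormedAlgebra ℝ 𝕜] (x : M) : Type _ :=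
  TangentSpace 𝓘(ℝ, E) x →L[ℝ] 𝕜

/-- The differential `df` of a function with values in `𝕜 = ℝ` or `ℂ`. -/
def differential {𝕜 : Type*} [NormedField 𝕜] [NormedAlgebra ℝ 𝕜] (f : M → 𝕜) (x : M) :
    Cotan (E := E) 𝕜 x :=
  mfderiv 𝓘(ℝ, E) 𝓘(ℝ, 𝕜) f x

/-- The differential at `x` of a chart `e`, as a linear map `T_x M → E`. -/
def chartDifferential (e : OpenPartialHomeomorph M E) (x : M) :
    TangentSpace 𝓘(ℝ, E) x →L[ℝ] E :=
  mfderiv 𝓘(ℝ, E) 𝓘(ℝ, E) e x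

variable (E M) in
/-- Smooth bivector fields. At each point `x` an element of `∧² T_x M` (for `𝕜 = ℝ`), respectively
of `∧² (T_x M ⊗ ℂ)` (for `𝕜 = ℂ`), is given as an alternating `𝕜`-bilinear form on the cotangent
space, respectively on the complexified cotangent space. Smoothness means that the coefficients
in every chart are smooth. -/
@[ext]
structure BivectorField (𝕜 : Type*) [NormedField 𝕜] [NormedAlgebra ℝ 𝕜] where
  toFun : ∀ x : M, Cotan (E := E) 𝕜 x →ₗ[𝕜] Cotan (E := E) 𝕜 x →ₗ[𝕜] 𝕜
  alternating : ∀ (x : M) (α : Cotan (E := E) 𝕜 x), toFun x α α = 0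
  smooth : ∀ e ∈ atlas E M, ∀ l m : E →L[ℝ] 𝕜,
    ContMDiffOn 𝓘(ℝ, E) 𝓘(ℝ, 𝕜) ∞
      (fun x => toFun x (l.comp (chartDifferential e x)) (m.comp (chartDifferential e x))) e.source

/-- The bracket `{f, g} = P(df, dg)` of functions with values in `𝕜 = ℝ` or `ℂ`. -/
def functionBracket {𝕜 : Type*} [NormedField 𝕜] [NormedAlgebra ℝ 𝕜]
    (P : BivectorField E M 𝕜) (f g : M → 𝕜) : M → 𝕜 :=
  fun x => P.toFun x (differential f x) (differential g x)

/-- The Schouten bracket `[P, Q]` of two bivector fields, as a tri-derivation of functions. -/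
def schoutenBracket {𝕜 : Type*} [NormedField 𝕜] [NormedAlgebra ℝ 𝕜]
    (P Q : BivectorField E M 𝕜) (f g h : M → 𝕜) : M → 𝕜 :=
  functionBracket P (functionBracket Q f g) h
    + functionBracket P (functionBracket Q g h) f
    + functionBracket P (functionBracket Q h f) g
    + functionBracket Q (functionBracket P f g) h
    + functionBracket Q (functionBracket P g h) f
    + functionBracket Q (functionBracket P h f) g

/-- The equation `[P, P] = 0`. -/
def SchoutenSquareZero {𝕜 : Type*} [NormedField 𝕜] [NormedAlgebra ℝ 𝕜]
    (P : BivectorField E M 𝕜) : Prop :=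
  ∀ f g h : M → 𝕜, ContMDiff 𝓘(ℝ, E) 𝓘(ℝ, 𝕜) ∞ f → ContMDiff 𝓘(ℝ, E) 𝓘(ℝ, 𝕜) ∞ g →
    ContMDiff 𝓘(ℝ, E) 𝓘(ℝ, 𝕜) ∞ h → schoutenBracket P P f g h = 0

/-- A Poisson tensor is a real bivector field `P` with `[P, P] = 0`. -/
def IsPoissonTensor (P : BivectorField E M ℝ) : Prop := SchoutenSquareZero P

/-- Smooth (real) vector fields. -/
def SmoothVectorField [IsManifold 𝓘(ℝ, E) ∞ M] (V : ∀ x : M, Tan (E := E) x) : Prop :=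
  ContMDiff 𝓘(ℝ, E) 𝓘(ℝ, E).tangent ∞ (fun x => (⟨x, V x⟩ : TangentBundle 𝓘(ℝ, E) M))

/-- Smooth (real) one-forms: smooth sections of the bundle of linear forms on tangent spaces. -/
def SmoothOneForm [IsManifold 𝓘(ℝ, E) ∞ M] (α : ∀ x : M, Cotan (E := E) ℝ x) : Prop :=
  ContMDiff 𝓘(ℝ, E) (𝓘(ℝ, E).prod 𝓘(ℝ, E →L[ℝ] ℝ)) ∞
    (fun x => (⟨x, α x⟩ : Bundle.TotalSpace (E →L[ℝ] ℝ)
      (fun x : M => TangentSpace 𝓘(ℝ, E) x →L[ℝ] Bundle.Trivial M ℝ x)))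

/-- The expression `E → E` of a vector field in the preferred chart at `x₀`. -/
def vectorFieldInChart (x₀ : M) (V : ∀ x : M, Tan (E := E) x) : E → E :=
  VectorField.mpullback 𝓘(ℝ, E) 𝓘(ℝ, E) (extChartAt 𝓘(ℝ, E) x₀).symm V

/-- The expression `E → E^*` of a one-form in the preferred chart at `x₀`. -/
def oneFormInChart (x₀ : M) (β : ∀ x : M, Cotan (E := E) ℝ x) : E → (E →L[ℝ] ℝ) :=
  fun y => (β ((extChartAt 𝓘(ℝ, E) x₀).symm y)).comp
    (mfderiv 𝓘(ℝ, E) 𝓘(ℝ, E) (extChartAt 𝓘(ℝ, E) x₀).symm y)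

/-- The Lie derivative `L_V β` of a one-form along a vector field. In a chart around `x₀` with
coordinate expressions `V'`, `β'` it is the one-form
`w ↦ (D_{V'} β') w + β' (D_w V')`, that is `(L_V β)_j = V^i ∂_i β_j + β_i ∂_j V^i`. -/
def lieDerivative (V : ∀ x : M, Tan (E := E) x) (β : ∀ x : M, Cotan (E := E) ℝ x) (x₀ : M) :
    Cotan (E := E) ℝ x₀ :=
  (fderiv ℝ (oneFormInChart x₀ β) (chartAt E x₀ x₀) (vectorFieldInChart x₀ V (chartAt E x₀ x₀))
    + (oneFormInChart x₀ β (chartAt E x₀ x₀)).comp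
        (fderiv ℝ (vectorFieldInChart x₀ V) (chartAt E x₀ x₀))).comp
    (chartDifferential (chartAt E x₀) x₀)

section Sharp

variable [FiniteDimensional ℝ E]

/-- For a bilinear form `P` on `T_x^* M`, the map `P^♯ : T_x^* M → T_x M` determined by
`β (P^♯ α) = P(α, β)`, see `apply_sharp`. -/
def sharp {x : M} (P : Cotan (E := E) ℝ x →ₗ[ℝ] Cotan (E := E) ℝ x →ₗ[ℝ] ℝ) :
    Cotan (E := E) ℝ x →ₗ[ℝ] Tan (E := E) x :=
  let toDoubleDual : Cotan (E := E) ℝ x →ₗ[ℝ] Module.Dual ℝ (Module.Dual ℝ E) :=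
    (LinearMap.lcomp ℝ ℝ
      (LinearMap.toContinuousLinearMap :
        (E →ₗ[ℝ] ℝ) ≃ₗ[ℝ] (E →L[ℝ] ℝ)).toLinearMap).comp P
  (Module.evalEquiv ℝ E).symm.toLinearMap.comp toDoubleDual

theorem apply_sharp {x : M} (P : Cotan (E := E) ℝ x →ₗ[ℝ] Cotan (E := E) ℝ x →ₗ[ℝ] ℝ)
    (α β : Cotan (E := E) ℝ x) : β (sharp P α) = P α β := by
  have key : ∀ (f : E →L[ℝ] ℝ) (g : Module.Dual ℝ (Module.Dual ℝ E)),
      f ((Module.evalEquiv ℝ E).symm g) = g f.toLinearMap := fun f g =>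
    Module.apply_evalEquiv_symm_apply ℝ E (f : E →ₗ[ℝ] ℝ) g
  exact key β _

/-- The bracket `[α, β]_P = L_{P^♯ α} β - L_{P^♯ β} α - d(P(α, β))` of one-forms. -/
def formBracket (P : ∀ x : M, Cotan (E := E) ℝ x →ₗ[ℝ] Cotan (E := E) ℝ x →ₗ[ℝ] ℝ)
    (α β : ∀ x : M, Cotan (E := E) ℝ x) (x : M) : Cotan (E := E) ℝ x :=
  lieDerivative (fun y => sharp (P y) (α y)) β x
    - lieDerivative (fun y => sharp (P y) (β y)) α x
    - differential (fun y => P y (α y) (β y)) x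

/-- The tensor `P_N` with `P_N^♯ = P^♯ ∘ N^*`, that is `P_N(α, β) = P(N^* α, β)`, where
`N^* α = α ∘ N`. -/
def deform (P : ∀ x : M, Cotan (E := E) ℝ x →ₗ[ℝ] Cotan (E := E) ℝ x →ₗ[ℝ] ℝ)
    (N : ∀ x : M, Tan (E := E) x →L[ℝ] Tan (E := E) x) (x : M) :
    Cotan (E := E) ℝ x →ₗ[ℝ] Cotan (E := E) ℝ x →ₗ[ℝ] ℝ :=
  (P x).comp
    ({ toFun := fun α => α.comp (N x)
       map_add' := fun _ _ => rfl
       map_smul' := fun _ _ => rfl } : Cotan (E := E) ℝ x →ₗ[ℝ] Cotan (E := E) ℝ x)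

end Sharp

/-- A Nijenhuis tensor: a smooth `(1,1)`-tensor `N` with vanishing Nijenhuis torsion
`[NV, NW] - N([NV, W] + [V, NW] - N[V, W])`. -/
structure IsNijenhuisTensor [IsManifold 𝓘(ℝ, E) ∞ M]
    (N : ∀ x : M, Tan (E := E) x →L[ℝ] Tan (E := E) x) : Prop where
  smooth : ∀ V : (∀ x : M, Tan (E := E) x), SmoothVectorField V →
    SmoothVectorField (fun x => N x (V x))
  torsion : ∀ V W : (∀ x : M, Tan (E := E) x), SmoothVectorField V → SmoothVectorField W →
    ∀ x : M,
      VectorField.mlieBracket 𝓘(ℝ, E) (fun y => N y (V y)) (fun y => N y (W y)) x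
        - N x (VectorField.mlieBracket 𝓘(ℝ, E) (fun y => N y (V y)) W x
            + VectorField.mlieBracket 𝓘(ℝ, E) V (fun y => N y (W y)) x
            - N x (VectorField.mlieBracket 𝓘(ℝ, E) V W x)) = 0

/-- Poisson–Nijenhuis structures `(P, N)`. -/
structure IsPoissonNijenhuis [FiniteDimensional ℝ E] [IsManifold 𝓘(ℝ, E) ∞ M]
    (P : BivectorField E M ℝ) (N : ∀ x : M, Tan (E := E) x →L[ℝ] Tan (E := E) x) : Prop where
  poisson : IsPoissonTensor P
  nijenhuis : IsNijenhuisTensor N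
  /-- `N ∘ P^♯ = P^♯ ∘ N^*` -/
  comm : ∀ (x : M) (α : Cotan (E := E) ℝ x),
    N x (sharp (P.toFun x) α) = sharp (P.toFun x) (α.comp (N x))
  /-- `[α, β]_{P_N} = [N^* α, β]_P + [α, N^* β]_P - N^* [α, β]_P` -/
  compat : ∀ α β : (∀ x : M, Cotan (E := E) ℝ x), SmoothOneForm α → SmoothOneForm β →
    ∀ x : M,
      formBracket (deform P.toFun N) α β x
        = formBracket P.toFun (fun y => (α y).comp (N y)) β x
          + formBracket P.toFun α (fun y => (β y).comp (N y)) x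
          - (formBracket P.toFun α β x).comp (N x)

/-! ### Generalized complex structures -/

/-- The fibre of `TM ⊕ T^*M` at `x`. -/
abbrev GenTan (x : M) : Type _ := Tan (E := E) x × Cotan (E := E) ℝ x

/-- Smooth sections of `TM ⊕ T^*M`. -/
def SmoothGenSection [IsManifold 𝓘(ℝ, E) ∞ M] (u : ∀ x : M, GenTan (E := E) x) : Prop :=
  SmoothVectorField (fun x => (u x).1) ∧ SmoothOneForm (fun x => (u x).2)

/-- The pairing `⟨V + α, W + β⟩ = (α(W) + β(V)) / 2` on `TM ⊕ T^*M`. -/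
def genPairing {x : M} (u v : GenTan (E := E) x) : ℝ := (u.2 v.1 + v.2 u.1) / 2

/-- The Courant bracket
`[V + α, W + β] = [V, W] + L_V β - L_W α + d(α(W) - β(V)) / 2` on sections of `TM ⊕ T^*M`. -/
def courantBracket (u v : ∀ x : M, GenTan (E := E) x) (x : M) : GenTan (E := E) x :=
  (VectorField.mlieBracket 𝓘(ℝ, E) (fun y => (u y).1) (fun y => (v y).1) x,
    lieDerivative (fun y => (u y).1) (fun y => (v y).2) x
      - lieDerivative (fun y => (v y).1) (fun y => (u y).2) x
      + (1 / 2 : ℝ) • differential (fun y => (u y).2 (v y).1 - (v y).2 (u y).1) x)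

/-- A generalized complex structure: a smooth endomorphism `𝒥` of `TM ⊕ T^*M` with `𝒥² = -1`,
orthogonal for the natural pairing, and integrable with respect to the Courant bracket. -/
structure IsGeneralizedComplex [IsManifold 𝓘(ℝ, E) ∞ M]
    (𝒥 : ∀ x : M, GenTan (E := E) x →ₗ[ℝ] GenTan (E := E) x) : Prop where
  smooth : ∀ u : (∀ x : M, GenTan (E := E) x), SmoothGenSection u →
    SmoothGenSection (fun x => 𝒥 x (u x))
  sq : ∀ (x : M) (u : GenTan (E := E) x), 𝒥 x (𝒥 x u) = -u
  orthogonal : ∀ (x : M) (u v : GenTan (E := E) x),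
    genPairing (𝒥 x u) (𝒥 x v) = genPairing u v
  integrable : ∀ u v : (∀ x : M, GenTan (E := E) x), SmoothGenSection u → SmoothGenSection v →
    ∀ x : M,
      courantBracket (fun y => 𝒥 y (u y)) (fun y => 𝒥 y (v y)) x - courantBracket u v x
        - 𝒥 x (courantBracket (fun y => 𝒥 y (u y)) v x
            + courantBracket u (fun y => 𝒥 y (v y)) x) = 0

/-- The endomorphism of `TM ⊕ T^*M` with block matrix `[[N, P^♯], [0, -N^*]]`. -/
def genMatrix [FiniteDimensional ℝ E] (P : BivectorField E M ℝ)
    (N : ∀ x : M, Tan (E := E) x →L[ℝ] Tan (E := E) x) (x : M) :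
    GenTan (E := E) x →ₗ[ℝ] GenTan (E := E) x where
  toFun u := (N x u.1 + sharp (P.toFun x) u.2, -(u.2.comp (N x)))
  map_add' u v := by
    ext w
    · simp only [Prod.fst_add, Prod.snd_add, map_add]
      abel
    · simp [add_comm]
  map_smul' c u := by
    ext w
    · simp
    · simp

end Real

/-! ### Complex manifolds -/

section Complex

variable {E : Type*} [NormedAddCommGroup E] [NormedSpace ℂ E]
  {M : Type*} [TopologicalSpace M] [ChartedSpace E M]

/-- A complex manifold is in particular a smooth real manifold. -/
instance realManifold [IsManifold 𝓘(ℂ, E) ω M] : IsManifold 𝓘(ℝ, E) ∞ M := by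
  apply isManifold_of_contDiffOn
  intro e e' he he'
  have h := (contDiffGroupoid ω 𝓘(ℂ, E)).compatible he he'
  have h3 := (mem_groupoid_of_pregroupoid.mp h).1
  have h4 : ContDiffOn ℂ ω (e.symm ≫ₕ e') (e.symm ≫ₕ e').source := by
    simpa [contDiffPregroupoid] using h3
  simpa using (h4.restrict_scalars ℝ).of_le le_top

variable (E M) in
/-- The almost complex structure `J` of a complex manifold: multiplication by `i` on tangent
spaces (which Mathlib identifies with the model space `E` through a holomorphic chart). -/
def almostComplex (x : M) : TangentSpace 𝓘(ℝ, E) x →L[ℝ] TangentSpace 𝓘(ℝ, E) x :=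
  ((Complex.I • ContinuousLinearMap.id ℂ E : E →L[ℂ] E).restrictScalars ℝ : E →L[ℝ] E)

/-- The complex-valued extension of a real covector. -/
def ofRealCovector {x : M} (α : Cotan (E := E) ℝ x) : Cotan (E := E) ℂ x :=
  Complex.ofRealCLM.comp α

theorem ofRealCovector_add {x : M} (α β : Cotan (E := E) ℝ x) :
    ofRealCovector (α + β) = ofRealCovector α + ofRealCovector β := by
  ext v
  simp [ofRealCovector]

theorem ofRealCovector_smul {x : M} (c : ℝ) (α : Cotan (E := E) ℝ x) :
    ofRealCovector (c • α) = (c : ℂ) • ofRealCovector α := by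
  ext v
  simp [ofRealCovector]

/-- The real part `π_R` of a complex bivector field `π = π_R + i π_I`. -/
def BivectorField.re (π : BivectorField E M ℂ) : BivectorField E M ℝ where
  toFun x := LinearMap.mk₂ ℝ
    (fun α β => (π.toFun x (ofRealCovector α) (ofRealCovector β)).re)
    (fun α α' β => by simp [ofRealCovector_add])
    (fun c α β => by simp [ofRealCovector_smul])
    (fun α β β' => by simp [ofRealCovector_add])
    (fun c α β => by simp [ofRealCovector_smul])
  alternating x α := by simp [π.alternating]
  smooth e he l m :=
    Complex.reCLM.contDiff.contMDiff.comp_contMDiffOn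
      (π.smooth e he (Complex.ofRealCLM.comp l) (Complex.ofRealCLM.comp m))

/-- The imaginary part `π_I` of a complex bivector field `π = π_R + i π_I`. -/
def BivectorField.im (π : BivectorField E M ℂ) : BivectorField E M ℝ where
  toFun x := LinearMap.mk₂ ℝ
    (fun α β => (π.toFun x (ofRealCovector α) (ofRealCovector β)).im)
    (fun α α' β => by simp [ofRealCovector_add])
    (fun c α β => by simp [ofRealCovector_smul])
    (fun α β β' => by simp [ofRealCovector_add])
    (fun c α β => by simp [ofRealCovector_smul])
  alternating x α := by simp [π.alternating]
  smooth e he l m :=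
    Complex.imCLM.contDiff.contMDiff.comp_contMDiffOn
      (π.smooth e he (Complex.ofRealCLM.comp l) (Complex.ofRealCLM.comp m))

/-- `π` is a section of `∧² T^{1,0}`: it vanishes as soon as one argument is a covector of type
`(0,1)`, that is a covector `α` with `α ∘ J = -i α`. -/
def IsTypeTwoZero (π : BivectorField E M ℂ) : Prop :=
  ∀ (x : M) (α β : Cotan (E := E) ℂ x),
    (∀ v, α (almostComplex E M x v) = -Complex.I * α v) → π.toFun x α β = 0

/-- `π` is a holomorphic bivector field: a section of `∧² T^{1,0}` with `∂̄π = 0`, that is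
the coefficients `π(dz_i, dz_j)` of `π` in holomorphic coordinates are holomorphic functions. -/
def IsHolomorphicBivector (π : BivectorField E M ℂ) : Prop :=
  IsTypeTwoZero π ∧
    ∀ e ∈ atlas E M, ∀ l m : E →L[ℂ] ℂ,
      MDifferentiableOn 𝓘(ℂ, E) 𝓘(ℂ, ℂ)
        (fun x => π.toFun x ((l.restrictScalars ℝ).comp (chartDifferential e x))
          ((m.restrictScalars ℝ).comp (chartDifferential e x))) e.source

/-- A holomorphic Poisson bivector field: a holomorphic bivector field with `[π, π] = 0`. -/
def IsHolomorphicPoisson (π : BivectorField E M ℂ) : Prop :=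
  IsHolomorphicBivector π ∧ SchoutenSquareZero π

end Complex

end HolPoisson

end

open HolPoisson

set_option maxSynthPendingDepth 3

noncomputable section

namespace HolPoisson

open Filter Topology

/-! ### Tensors and brackets in the preferred charts of a real manifold -/

section RealCharts

variable {E : Type*} [NormedAddCommGroup E] [NormedSpace ℝ E]
  {M : Type*} [TopologicalSpace M] [ChartedSpace E M]

/-! All three conditions are local and of first order, so each can be read off at a point from the
value `q` and the derivative `D` of the coordinate expression of `π_I^♯`. In holomorphic charts `J`
is the constant matrix `i` (`constantInCharts_almostComplex`), so `J` itself contributes no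
derivatives.

The relation `π_R^♯ = π_I^♯ ∘ J^*` says exactly that `π` has type (2,0) (`isTypeTwoZero_iff_sharp`).
It implies `J ∘ π_I^♯ = π_I^♯ ∘ J^*`. Under this algebraic relation each of (a), (b), (c) becomes
the same pair of conditions at every point: `D (Jz) = J ∘ D z` (`JetHolomorphic`) and the vanishing
of the cyclic sum of `c (D (q a) b)` (`JetPoisson`).

For (a), the Cauchy–Riemann equations for `π` reduce to those for its imaginary part
(`IsTypeTwoZero.isHolomorphicBivector_iff`). For holomorphic `π`, the Jacobiator on real covectors
is `-2 Jac(a,b,c) + 2i Jac(J^*a,b,c)`, where `Jac` is that of `π_I`. Hence `[π,π] = 0` iff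
`[π_I,π_I] = 0` (`HolomorphicJet.jacobiator_complexify`).

For (b), constancy of `J` makes its Nijenhuis torsion vanish, and the compatibility of the brackets
of one-forms is equivalent to holomorphy (`ConstantInCharts.compatible_iff`).

For (c), the square and the orthogonality of the block matrix are algebraic. On one-forms with
constant coefficients the form part of the Courant torsion gives holomorphy and the vector part
gives the Poisson condition. Conversely, these two conditions annihilate the torsion on all
sections, whose derivatives cancel (`ConstantInCharts.isGeneralizedComplex_iff`). -/

theorem chartDifferential_comp_mfderiv_symm [IsManifold 𝓘(ℝ, E) ∞ M]
    {e : OpenPartialHomeomorph M E} (he : e ∈ atlas E M) {y : E} (hy : y ∈ e.target) :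
    (chartDifferential e (e.symm y)).comp
      (mfderiv 𝓘(ℝ, E) 𝓘(ℝ, E) e.symm y : E →L[ℝ] E) = ContinuousLinearMap.id ℝ E := by
  have : IsManifold 𝓘(ℝ, E) 1 M := IsManifold.of_le (n := ∞) (by simp)
  exact (mdifferentiable_of_mem_atlas he).comp_symm_deriv hy

theorem mfderiv_symm_comp_chartDifferential [IsManifold 𝓘(ℝ, E) ∞ M]
    {e : OpenPartialHomeomorph M E} (he : e ∈ atlas E M) {y : E} (hy : y ∈ e.target) :
    (mfderiv 𝓘(ℝ, E) 𝓘(ℝ, E) e.symm y : E →L[ℝ] E).comp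
      (chartDifferential e (e.symm y)) = ContinuousLinearMap.id ℝ E := by
  have : IsManifold 𝓘(ℝ, E) 1 M := IsManifold.of_le (n := ∞) (by simp)
  have := (mdifferentiable_of_mem_atlas (I := 𝓘(ℝ, E)) he).symm_comp_deriv (e.map_target hy)
  rw [e.right_inv hy] at this
  exact this

/-- The tangent space at `x` is identified with the model space through the preferred chart at `x`
itself. Consequently, at the centre of a chart a tensor coincides with its coordinate expression. -/
theorem chartDifferential_chartAt_self [IsManifold 𝓘(ℝ, E) ∞ M] (x : M) :
    chartDifferential (chartAt E x) x = ContinuousLinearMap.id ℝ E := by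
  have : IsManifold 𝓘(ℝ, E) 1 M := IsManifold.of_le (n := ∞) (by simp)
  refine (mfderiv_chartAt_eq_tangentCoordChange (I := 𝓘(ℝ, E)) (mem_chart_source E x)).trans ?_
  ext v
  exact tangentCoordChange_self (by simp)

/-- The differential at `y` of the inverse of the preferred chart at `x₀`. -/
def frame (x₀ : M) (y : E) : E →L[ℝ] E :=
  mfderiv 𝓘(ℝ, E) 𝓘(ℝ, E) (chartAt E x₀).symm y

/-- The differential of the preferred chart at `x₀`, at the point with coordinates `y`. -/
def coframe (x₀ : M) (y : E) : E →L[ℝ] E :=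
  chartDifferential (chartAt E x₀) ((chartAt E x₀).symm y)

theorem coframe_comp_frame [IsManifold 𝓘(ℝ, E) ∞ M] (x₀ : M) {y : E}
    (hy : y ∈ (chartAt E x₀).target) :
    (coframe x₀ y).comp (frame x₀ y) = ContinuousLinearMap.id ℝ E :=
  chartDifferential_comp_mfderiv_symm (chart_mem_atlas E x₀) hy

theorem frame_comp_coframe [IsManifold 𝓘(ℝ, E) ∞ M] (x₀ : M) {y : E}
    (hy : y ∈ (chartAt E x₀).target) :
    (frame x₀ y).comp (coframe x₀ y) = ContinuousLinearMap.id ℝ E :=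
  mfderiv_symm_comp_chartDifferential (chart_mem_atlas E x₀) hy

theorem coframe_self [IsManifold 𝓘(ℝ, E) ∞ M] (x₀ : M) :
    coframe x₀ (chartAt E x₀ x₀) = ContinuousLinearMap.id ℝ E := by
  rw [coframe, (chartAt E x₀).left_inv (mem_chart_source E x₀)]
  exact chartDifferential_chartAt_self x₀

theorem coe_extChartAt_symm (x : M) :
    ((extChartAt 𝓘(ℝ, E) x).symm : E → M) = (chartAt E x).symm := by
  ext y; simp

/-- A covector at `x`, seen as a linear form on the model space. -/
def modelCovector {𝕜 : Type*} [NormedField 𝕜] [NormedAlgebra ℝ 𝕜] {x : M}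
    (α : Cotan (E := E) 𝕜 x) : E →L[ℝ] 𝕜 := α

/-- The coordinate expression of a field of covectors in the preferred chart at `x₀`. -/
def covectorInChart {𝕜 : Type*} [NormedField 𝕜] [NormedAlgebra ℝ 𝕜] (x₀ : M)
    (β : ∀ x : M, Cotan (E := E) 𝕜 x) (y : E) : E →L[ℝ] 𝕜 :=
  (modelCovector (β ((chartAt E x₀).symm y))).comp (frame x₀ y)

theorem oneFormInChart_eq (x₀ : M) (β : ∀ x : M, Cotan (E := E) ℝ x) :
    oneFormInChart x₀ β = covectorInChart x₀ β := by
  unfold oneFormInChart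
  rw [coe_extChartAt_symm]; rfl

theorem vectorFieldInChart_apply [IsManifold 𝓘(ℝ, E) ∞ M] (x₀ : M)
    (V : ∀ x : M, Tan (E := E) x) {y : E} (hy : y ∈ (chartAt E x₀).target) :
    vectorFieldInChart x₀ V y = coframe x₀ y (V ((chartAt E x₀).symm y)) := by
  have h : (frame x₀ y).inverse = coframe x₀ y :=
    ContinuousLinearMap.inverse_eq (frame_comp_coframe x₀ hy) (coframe_comp_frame x₀ hy)
  rw [← h, vectorFieldInChart, VectorField.mpullback_apply, coe_extChartAt_symm]
  rfl

theorem differential_eq_fderiv {𝕜 : Type*} [NormedField 𝕜] [NormedAlgebra ℝ 𝕜]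
    {f : M → 𝕜} {x₀ : M} (hf : MDifferentiableAt 𝓘(ℝ, E) 𝓘(ℝ, 𝕜) f x₀) :
    differential f x₀ = fderiv ℝ (f ∘ (chartAt E x₀).symm) (chartAt E x₀ x₀) := by
  rw [differential, hf.mfderiv]
  simp [writtenInExtChartAt, fderivWithin_univ]
  rfl

/-- The manifold bracket is the flat bracket transported by the chart differential, which is the
identity at the centre. -/
theorem mlieBracket_eq_lieBracket [IsManifold 𝓘(ℝ, E) ∞ M] (V W : ∀ x : M, Tan (E := E) x)
    (x₀ : M) : VectorField.mlieBracket 𝓘(ℝ, E) V W x₀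
      = VectorField.lieBracket ℝ (vectorFieldInChart x₀ V) (vectorFieldInChart x₀ W)
        (chartAt E x₀ x₀) := by
  have h : (mfderiv 𝓘(ℝ, E) 𝓘(ℝ, E) (extChartAt 𝓘(ℝ, E) x₀) x₀ : E →L[ℝ] E).inverse
      = ContinuousLinearMap.id ℝ E := by
    have h1 := chartDifferential_chartAt_self (E := E) x₀
    have h2 : (extChartAt 𝓘(ℝ, E) x₀ : M → E) = chartAt E x₀ := by ext; simp
    rw [h2]
    unfold chartDifferential at h1
    rw [show (mfderiv 𝓘(ℝ, E) 𝓘(ℝ, E) (chartAt E x₀) x₀ : E →L[ℝ] E) = _ from h1]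
    exact ContinuousLinearMap.inverse_id
  rw [← VectorField.mlieBracketWithin_univ, VectorField.mlieBracketWithin_apply]
  rw [show ∀ v : E, (mfderiv 𝓘(ℝ, E) 𝓘(ℝ, E) (extChartAt 𝓘(ℝ, E) x₀) x₀ : E →L[ℝ] E).inverse v = v
    from fun v => by rw [h]; rfl]
  simp only [modelWithCornersSelf_coe, Set.range_id, Set.preimage_univ, Set.inter_univ,
    VectorField.mpullbackWithin_univ]
  change VectorField.lieBracketWithin ℝ (vectorFieldInChart x₀ V) (vectorFieldInChart x₀ W)
    Set.univ _ = _
  rw [VectorField.lieBracketWithin_univ]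
  have h5 : extChartAt 𝓘(ℝ, E) x₀ x₀ = chartAt E x₀ x₀ := by simp
  rw [h5]

/-- The Lie derivative of a one-form along a vector field on a vector space. -/
def flatLieDerivative (V : E → E) (β : E → E →L[ℝ] ℝ) (y : E) : E →L[ℝ] ℝ :=
  fderiv ℝ β y (V y) + (β y).comp (fderiv ℝ V y)

theorem lieDerivative_eq [IsManifold 𝓘(ℝ, E) ∞ M] (V : ∀ x : M, Tan (E := E) x)
    (β : ∀ x : M, Cotan (E := E) ℝ x) (x₀ : M) :
    lieDerivative V β x₀ = flatLieDerivative (vectorFieldInChart x₀ V) (oneFormInChart x₀ β)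
      (chartAt E x₀ x₀) := by
  unfold lieDerivative
  rw [chartDifferential_chartAt_self]
  rfl

theorem contDiffAt_congr_iff {F : Type*} [NormedAddCommGroup F] [NormedSpace ℝ F] {f g : E → F}
    {y : E} {n : WithTop ℕ∞} (h : f =ᶠ[𝓝 y] g) : ContDiffAt ℝ n f y ↔ ContDiffAt ℝ n g y :=
  ⟨fun hf => hf.congr_of_eventuallyEq h.symm, fun hg => hg.congr_of_eventuallyEq h⟩

theorem contMDiffAt_iff_comp_chartAt_symm {F : Type*} [NormedAddCommGroup F] [NormedSpace ℝ F]
    [IsManifold 𝓘(ℝ, E) ∞ M] {f : M → F} {x₀ : M} :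
    ContMDiffAt 𝓘(ℝ, E) 𝓘(ℝ, F) ∞ f x₀
      ↔ ContDiffAt ℝ ∞ (f ∘ (chartAt E x₀).symm) (chartAt E x₀ x₀) := by
  rw [contMDiffAt_iff]
  have h1 : (chartAt E x₀).symm (chartAt E x₀ x₀) = x₀ :=
    (chartAt E x₀).left_inv (mem_chart_source E x₀)
  simp only [mfld_simps, Set.range_id, contDiffWithinAt_univ]
  rw [chartAt_self_eq]
  refine ⟨fun h => h.2, fun h => ⟨?_, h⟩⟩
  have h2 := ((chartAt E x₀).symm.continuousAt_iff_continuousAt_comp_right (f := f)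
    (x := x₀) (by simp)).2
  exact h2 (by simpa using h.continuousAt)

/-- Smoothness at `x₀` is tested in the trivialization centred at `x₀`, whose fibre map is the
coordinate change given by the chart differential. This is why the centre of each preferred chart
suffices. -/
theorem smoothVectorField_iff [IsManifold 𝓘(ℝ, E) ∞ M] {V : ∀ x : M, Tan (E := E) x} :
    SmoothVectorField V
      ↔ ∀ x₀ : M, ContDiffAt ℝ ∞ (vectorFieldInChart x₀ V) (chartAt E x₀ x₀) := by
  have : IsManifold 𝓘(ℝ, E) 1 M := IsManifold.of_le (n := ∞) (by simp)
  refine forall_congr' fun x₀ => ?_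
  rw [Bundle.contMDiffAt_section, contMDiffAt_iff_comp_chartAt_symm]
  refine contDiffAt_congr_iff ?_
  filter_upwards [(chartAt E x₀).open_target.mem_nhds (mem_chart_target E x₀)] with y hy
  rw [vectorFieldInChart_apply x₀ V hy]
  have := mfderiv_chartAt_eq_tangentCoordChange (I := 𝓘(ℝ, E)) ((chartAt E x₀).map_target hy)
  unfold coframe chartDifferential
  rw [this]
  rfl

theorem smoothOneForm_iff [IsManifold 𝓘(ℝ, E) ∞ M] {α : ∀ x : M, Cotan (E := E) ℝ x} :
    SmoothOneForm α
      ↔ ∀ x₀ : M, ContDiffAt ℝ ∞ (oneFormInChart x₀ α) (chartAt E x₀ x₀) := by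
  have : IsManifold 𝓘(ℝ, E) 1 M := IsManifold.of_le (n := ∞) (by simp)
  refine forall_congr' fun x₀ => ?_
  rw [contMDiffAt_hom_bundle]
  refine (and_iff_right contMDiffAt_id).trans ?_
  rw [contMDiffAt_iff_comp_chartAt_symm]
  refine contDiffAt_congr_iff ?_
  filter_upwards [(chartAt E x₀).open_target.mem_nhds (mem_chart_target E x₀)] with y hy
  rw [oneFormInChart_eq]
  unfold covectorInChart frame
  have h1 := TangentBundle.symmL_trivializationAt (I := 𝓘(ℝ, E)) ((chartAt E x₀).map_target hy)
  have h2 : extChartAt 𝓘(ℝ, E) x₀ ((chartAt E x₀).symm y) = y := by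
    simpa using (chartAt E x₀).right_inv hy
  rw [coe_extChartAt_symm, h2, modelWithCornersSelf_coe, Set.range_id, mfderivWithin_univ] at h1
  unfold ContinuousLinearMap.inCoordinates
  simp only [Function.comp_apply]
  rw [h1]
  ext w
  simp
  rfl

end RealCharts

/-! ### Prescribed germs, and bivector fields in coordinates -/

section BivectorCharts

variable {E : Type*} [NormedAddCommGroup E] [NormedSpace ℝ E]
  {M : Type*} [TopologicalSpace M] [ChartedSpace E M]

theorem covectorInChart_differential {𝕜 : Type*} [NormedField 𝕜] [NormedAlgebra ℝ 𝕜]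
    [IsManifold 𝓘(ℝ, E) ∞ M] {f : M → 𝕜} (hf : MDifferentiable 𝓘(ℝ, E) 𝓘(ℝ, 𝕜) f)
    (x₀ : M) {y : E} (hy : y ∈ (chartAt E x₀).target) :
    covectorInChart x₀ (differential f) y = fderiv ℝ (f ∘ (chartAt E x₀).symm) y := by
  have : IsManifold 𝓘(ℝ, E) 1 M := IsManifold.of_le (n := ∞) (by simp)
  rw [← mfderiv_eq_fderiv]
  exact (mfderiv_comp y (hf _) (mdifferentiableAt_atlas_symm (chart_mem_atlas E x₀) hy)).symm

theorem ContMDiff.smoothOneForm_differential [IsManifold 𝓘(ℝ, E) ∞ M] {f : M → ℝ}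
    (hf : ContMDiff 𝓘(ℝ, E) 𝓘(ℝ, ℝ) ∞ f) : SmoothOneForm (differential (E := E) f) := by
  rw [smoothOneForm_iff]
  intro x₀
  rw [contDiffAt_congr_iff (g := fderiv ℝ (f ∘ (chartAt E x₀).symm))]
  · exact (contMDiffAt_iff_comp_chartAt_symm.1 (hf x₀)).fderiv_right (by simp)
  · filter_upwards [(chartAt E x₀).open_target.mem_nhds (mem_chart_target E x₀)] with y hy
    rw [oneFormInChart_eq]
    exact covectorInChart_differential (hf.mdifferentiable (by simp)) x₀ hy

/-- Smooth functions with prescribed germ, via bump functions. -/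
theorem exists_contMDiff_eventuallyEq [FiniteDimensional ℝ E] [T2Space M]
    [IsManifold 𝓘(ℝ, E) ∞ M] {F : Type*} [NormedAddCommGroup F] [NormedSpace ℝ F]
    (l : E →L[ℝ] F) (x₀ : M) :
    ∃ f : M → F, ContMDiff 𝓘(ℝ, E) 𝓘(ℝ, F) ∞ f ∧
      f ∘ (chartAt E x₀).symm =ᶠ[𝓝 (chartAt E x₀ x₀)] l := by
  let b : SmoothBumpFunction 𝓘(ℝ, E) x₀ := Classical.arbitrary _
  refine ⟨fun x => b x • l (chartAt E x₀ x), b.contMDiff_smul ?_, ?_⟩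
  · exact l.contDiff.contMDiff.comp_contMDiffOn
      (contMDiffOn_of_mem_maximalAtlas (IsManifold.chart_mem_maximalAtlas x₀))
  · have h1 : ContinuousAt (chartAt E x₀).symm (chartAt E x₀ x₀) :=
      (chartAt E x₀).continuousAt_symm (mem_chart_target E x₀)
    have h2 : ∀ᶠ x in 𝓝 ((chartAt E x₀).symm (chartAt E x₀ x₀)), b x = 1 := by
      rw [(chartAt E x₀).left_inv (mem_chart_source E x₀)]
      exact b.eventuallyEq_one
    filter_upwards [h1.eventually h2,
      (chartAt E x₀).open_target.mem_nhds (mem_chart_target E x₀)] with y hy hy'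
    simp [hy, (chartAt E x₀).right_inv hy']

/-- The differential of a function with linear germ has constant coefficients near the point. Such
forms have arbitrary value and zero derivative, so they isolate the jet of the bivector field in a
bracket identity. -/
theorem exists_smoothOneForm_eventuallyEq [FiniteDimensional ℝ E] [T2Space M]
    [IsManifold 𝓘(ℝ, E) ∞ M] (l : E →L[ℝ] ℝ) (x₀ : M) :
    ∃ α : (∀ x : M, Cotan (E := E) ℝ x), SmoothOneForm α ∧
      oneFormInChart x₀ α =ᶠ[𝓝 (chartAt E x₀ x₀)] fun _ => l := by
  obtain ⟨f, hf, hfl⟩ := exists_contMDiff_eventuallyEq l x₀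
  refine ⟨differential f, ContMDiff.smoothOneForm_differential hf, ?_⟩
  filter_upwards [hfl.eventuallyEq_nhds,
    (chartAt E x₀).open_target.mem_nhds (mem_chart_target E x₀)] with y hy hy'
  rw [oneFormInChart_eq, covectorInChart_differential (hf.mdifferentiable (by simp)) x₀ hy', hy.fderiv_eq, l.fderiv]

variable {𝕜 : Type*} [NormedField 𝕜] [NormedAlgebra ℝ 𝕜]
  [FiniteDimensional ℝ E] [FiniteDimensional ℝ 𝕜]

/-- The continuous bilinear map underlying a bilinear form on a finite-dimensional space. -/
def continuousBilinear (B : (E →L[ℝ] 𝕜) →ₗ[𝕜] (E →L[ℝ] 𝕜) →ₗ[𝕜] 𝕜) :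
    (E →L[ℝ] 𝕜) →L[ℝ] (E →L[ℝ] 𝕜) →L[ℝ] 𝕜 :=
  LinearMap.toContinuousLinearMap
    ((LinearMap.toContinuousLinearMap (𝕜 := ℝ) (E := E →L[ℝ] 𝕜) (F' := 𝕜)).toLinearMap.comp
      (LinearMap.mk₂ ℝ (fun l m => B l m) (fun l l' m => by simp)
        (fun c l m => by
          rw [← algebraMap_smul 𝕜 c l, map_smul, LinearMap.smul_apply, algebraMap_smul])
        (fun l m m' => by simp)
        (fun c l m => by
          rw [← algebraMap_smul 𝕜 c m, map_smul, algebraMap_smul])))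

@[simp] theorem continuousBilinear_apply
    (B : (E →L[ℝ] 𝕜) →ₗ[𝕜] (E →L[ℝ] 𝕜) →ₗ[𝕜] 𝕜) (l m : E →L[ℝ] 𝕜) :
    continuousBilinear B l m = B l m := rfl

theorem continuousBilinear_smul_left (B : (E →L[ℝ] 𝕜) →ₗ[𝕜] (E →L[ℝ] 𝕜) →ₗ[𝕜] 𝕜) (c : 𝕜)
    (l m : E →L[ℝ] 𝕜) : continuousBilinear B (c • l) m = c * continuousBilinear B l m := by
  simp

/-- The coefficients of a bivector field in the preferred chart at `x₀`. -/
def bivectorInChart (P : BivectorField E M 𝕜) (x₀ : M) (y : E) :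
    (E →L[ℝ] 𝕜) →L[ℝ] (E →L[ℝ] 𝕜) →L[ℝ] 𝕜 :=
  (continuousBilinear (E := E) (P.toFun ((chartAt E x₀).symm y))).bilinearComp
    (ContinuousLinearMap.precomp 𝕜 (coframe x₀ y)) (ContinuousLinearMap.precomp 𝕜 (coframe x₀ y))

theorem bivectorInChart_apply (P : BivectorField E M 𝕜) (x₀ : M) (y : E) (l m : E →L[ℝ] 𝕜) :
    bivectorInChart P x₀ y l m = continuousBilinear (E := E) (P.toFun ((chartAt E x₀).symm y))
      (l.comp (coframe x₀ y)) (m.comp (coframe x₀ y)) := rfl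

theorem bivectorInChart_self [IsManifold 𝓘(ℝ, E) ∞ M] (P : BivectorField E M 𝕜) (x₀ : M) :
    bivectorInChart P x₀ (chartAt E x₀ x₀) = continuousBilinear (E := E) (P.toFun x₀) := by
  ext l m
  rw [bivectorInChart_apply, coframe_self, (chartAt E x₀).left_inv (mem_chart_source E x₀)]
  rfl

theorem bivectorInChart_covectorInChart [IsManifold 𝓘(ℝ, E) ∞ M] (P : BivectorField E M 𝕜)
    (x₀ : M) {y : E} (hy : y ∈ (chartAt E x₀).target) (α β : ∀ x : M, Cotan (E := E) 𝕜 x) :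
    bivectorInChart P x₀ y (covectorInChart x₀ α y) (covectorInChart x₀ β y)
      = P.toFun ((chartAt E x₀).symm y) (α ((chartAt E x₀).symm y))
        (β ((chartAt E x₀).symm y)) := by
  rw [bivectorInChart_apply, covectorInChart, covectorInChart, ContinuousLinearMap.comp_assoc,
    ContinuousLinearMap.comp_assoc, frame_comp_coframe x₀ hy]
  rfl

theorem bivectorInChart_self_left (P : BivectorField E M 𝕜) (x₀ : M) (y : E) (l : E →L[ℝ] 𝕜) :
    bivectorInChart P x₀ y l l = 0 := P.alternating _ _

theorem bivectorInChart_swap (P : BivectorField E M 𝕜) (x₀ : M) (y : E) (l m : E →L[ℝ] 𝕜) :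
    bivectorInChart P x₀ y l m = -bivectorInChart P x₀ y m l := by
  have h := bivectorInChart_self_left P x₀ y (l + m)
  simp only [map_add, add_apply, bivectorInChart_self_left] at h
  linear_combination h

theorem bivectorInChart_smul_left (P : BivectorField E M 𝕜) (x₀ : M) (y : E) (c : 𝕜)
    (l m : E →L[ℝ] 𝕜) :
    bivectorInChart P x₀ y (c • l) m = c * bivectorInChart P x₀ y l m := by
  exact continuousBilinear_smul_left (E := E) (P.toFun ((chartAt E x₀).symm y)) c
    (l.comp (coframe x₀ y)) (m.comp (coframe x₀ y))

/-- In finite dimension a family of operators is smooth once its evaluations are; evaluating at two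
constant forms gives the coefficients assumed smooth in `BivectorField`. -/
theorem contDiffOn_bivectorInChart [IsManifold 𝓘(ℝ, E) ∞ M] (P : BivectorField E M 𝕜) (x₀ : M) :
    ContDiffOn ℝ ∞ (bivectorInChart P x₀) (chartAt E x₀).target := by
  rw [contDiffOn_clm_apply]
  intro l
  rw [contDiffOn_clm_apply]
  intro m
  rw [← contMDiffOn_iff_contDiffOn]
  exact (P.smooth _ (chart_mem_atlas E x₀) l m).comp
    (contMDiffOn_symm_of_mem_maximalAtlas (IsManifold.chart_mem_maximalAtlas x₀))
    fun y hy => (chartAt E x₀).map_target hy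

theorem contDiffAt_bivectorInChart [IsManifold 𝓘(ℝ, E) ∞ M] (P : BivectorField E M 𝕜) (x₀ : M) :
    ContDiffAt ℝ ∞ (bivectorInChart P x₀) (chartAt E x₀ x₀) :=
  (contDiffOn_bivectorInChart P x₀).contDiffAt
    ((chartAt E x₀).open_target.mem_nhds (mem_chart_target E x₀))

theorem functionBracket_eq_bivectorInChart [IsManifold 𝓘(ℝ, E) ∞ M] (P : BivectorField E M 𝕜)
    {f g : M → 𝕜} (hf : MDifferentiable 𝓘(ℝ, E) 𝓘(ℝ, 𝕜) f)
    (hg : MDifferentiable 𝓘(ℝ, E) 𝓘(ℝ, 𝕜) g) (x₀ : M) {y : E}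
    (hy : y ∈ (chartAt E x₀).target) :
    functionBracket P f g ((chartAt E x₀).symm y) = bivectorInChart P x₀ y
      (fderiv ℝ (f ∘ (chartAt E x₀).symm) y) (fderiv ℝ (g ∘ (chartAt E x₀).symm) y) := by
  rw [← covectorInChart_differential hf x₀ hy, ← covectorInChart_differential hg x₀ hy,
    bivectorInChart_covectorInChart P x₀ hy]
  rfl

theorem ContMDiff.functionBracket [IsManifold 𝓘(ℝ, E) ∞ M] (P : BivectorField E M 𝕜)
    {f g : M → 𝕜} (hf : ContMDiff 𝓘(ℝ, E) 𝓘(ℝ, 𝕜) ∞ f) (hg : ContMDiff 𝓘(ℝ, E) 𝓘(ℝ, 𝕜) ∞ g) :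
    ContMDiff 𝓘(ℝ, E) 𝓘(ℝ, 𝕜) ∞ (functionBracket P f g) := by
  intro x₀
  rw [contMDiffAt_iff_comp_chartAt_symm]
  have hf' := (contMDiffAt_iff_comp_chartAt_symm.1 (hf x₀)).fderiv_right (m := ∞) (by simp)
  have hg' := (contMDiffAt_iff_comp_chartAt_symm.1 (hg x₀)).fderiv_right (m := ∞) (by simp)
  refine (contDiffAt_congr_iff ?_).2
    (((contDiffAt_bivectorInChart P x₀).clm_apply hf').clm_apply hg')
  filter_upwards [(chartAt E x₀).open_target.mem_nhds (mem_chart_target E x₀)] with y hy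
  exact functionBracket_eq_bivectorInChart P (hf.mdifferentiable (by simp))
    (hg.mdifferentiable (by simp)) x₀ hy

end BivectorCharts

/-! ### Linear algebra of the first jet of a bivector field -/

section Jets

variable {E : Type*} [NormedAddCommGroup E] [NormedSpace ℝ E]

/-- The value on `z` of the form part of the Courant bracket of two sections of `TE ⊕ T^*E` with
values `v + a`, `w + b` and derivatives `v' + a'`, `w' + b'` at the given point. -/
def jetCourantForm (v : E) (v' : E → E) (a : E →L[ℝ] ℝ) (a' : E → E →L[ℝ] ℝ)
    (w : E) (w' : E → E) (b : E →L[ℝ] ℝ) (b' : E → E →L[ℝ] ℝ) (z : E) : ℝ :=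
  (b' v z + b (v' z)) - (a' w z + a (w' z))
    + 1 / 2 * (a' z w + a (w' z) - (b' z v + b (v' z)))

variable (J : E →L[ℝ] E) (q : (E →L[ℝ] ℝ) →L[ℝ] E) (D : E →L[ℝ] (E →L[ℝ] ℝ) →L[ℝ] E)

/-- The algebraic identities satisfied by the value `q` and the derivative `D` at a point of `P^♯`
for a bivector field `P` with `J ∘ P^♯ = P^♯ ∘ J^*`, where `J` is a constant complex structure. -/
structure BivectorJet : Prop where
  sq : ∀ v, J (J v) = -v
  skew : ∀ l m : E →L[ℝ] ℝ, m (q l) = -l (q m)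
  comm : ∀ l : E →L[ℝ] ℝ, q (l.comp J) = J (q l)
  skew' : ∀ z (l m : E →L[ℝ] ℝ), m (D z l) = -l (D z m)
  comm' : ∀ z (l : E →L[ℝ] ℝ), D z (l.comp J) = J (D z l)

/-- The first-order condition at a point expressing that `P` is `J`-holomorphic. -/
def JetHolomorphic : Prop := ∀ (z : E) (l : E →L[ℝ] ℝ), D (J z) l = J (D z l)

/-- The first-order condition at a point expressing that `[P, P] = 0`. -/
def JetPoisson : Prop := ∀ a b c : E →L[ℝ] ℝ,
  c (D (q a) b) + a (D (q b) c) + b (D (q c) a) = 0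

variable {J q D}

variable (J q D) in
/-- The form part of `[𝒥u, v] + [u, 𝒥v]` is `ξ`, for sections `u`, `v` with values `v + a`, `w + b`
and derivatives `v' + a'`, `w' + b'`, where `𝒥` is the endomorphism with blocks `J`, `P^♯`, `0`,
`-J^*`. -/
def IsMixedCourantForm (v : E) (v' : E →L[ℝ] E) (a : E →L[ℝ] ℝ) (a' : E →L[ℝ] E →L[ℝ] ℝ)
    (w : E) (w' : E →L[ℝ] E) (b : E →L[ℝ] ℝ) (b' : E →L[ℝ] E →L[ℝ] ℝ) (ξ : E →L[ℝ] ℝ) : Prop :=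
  ∀ z, ξ z =
    jetCourantForm (J v + q a) (fun z => J (v' z) + (D z a + q (a' z)))
        (-(a.comp J)) (fun z => -((a' z).comp J)) w w' b b' z
      + jetCourantForm v v' a a' (J w + q b) (fun z => J (w' z) + (D z b + q (b' z)))
        (-(b.comp J)) (fun z => -((b' z).comp J)) z

variable (J q D) in
/-- The vector part of the Courant torsion vanishes; notation as in `IsMixedCourantForm`. -/
def JetVectorTorsionFree (v : E) (v' : E →L[ℝ] E) (a : E →L[ℝ] ℝ) (a' : E →L[ℝ] E →L[ℝ] ℝ)
    (w : E) (w' : E →L[ℝ] E) (b : E →L[ℝ] ℝ) (b' : E →L[ℝ] E →L[ℝ] ℝ) (ξ : E →L[ℝ] ℝ) : Prop :=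
  ((J (w' (J v + q a)) + (D (J v + q a) b + q (b' (J v + q a))))
      - (J (v' (J w + q b)) + (D (J w + q b) a + q (a' (J w + q b)))))
    - (w' v - v' w)
    - (J ((w' (J v + q a) - (J (v' w) + (D w a + q (a' w))))
        + ((J (w' v) + (D v b + q (b' v))) - v' (J w + q b))) + q ξ) = 0

variable (J q D) in
/-- The form part of the Courant torsion vanishes; notation as in `IsMixedCourantForm`. -/
def JetFormTorsionFree (v : E) (v' : E →L[ℝ] E) (a : E →L[ℝ] ℝ) (a' : E →L[ℝ] E →L[ℝ] ℝ)
    (w : E) (w' : E →L[ℝ] E) (b : E →L[ℝ] ℝ) (b' : E →L[ℝ] E →L[ℝ] ℝ) (ξ : E →L[ℝ] ℝ) : Prop :=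
  ∀ z, jetCourantForm (J v + q a) (fun z => J (v' z) + (D z a + q (a' z)))
        (-(a.comp J)) (fun z => -((a' z).comp J))
        (J w + q b) (fun z => J (w' z) + (D z b + q (b' z)))
        (-(b.comp J)) (fun z => -((b' z).comp J)) z
      - jetCourantForm v v' a a' w w' b b' z + ξ (J z) = 0

/-- Pairing with a covector `c` turns `q ξ` into `-ξ (q c)`, where `ξ` is explicit. Holomorphy
cancels the derivatives of `P^♯` along `J v` and `J w` against those along `v` and `w`. The
derivatives along `q a`, `q b`, `q c` form the cyclic sum of the Poisson condition. Derivatives of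
the sections cancel by skewness and commutation. -/
theorem jetVectorTorsionFree (h : BivectorJet J q D) (hH : JetHolomorphic J D)
    (hT : JetPoisson q D)
    {v : E} {v' : E →L[ℝ] E} {a : E →L[ℝ] ℝ} {a' : E →L[ℝ] E →L[ℝ] ℝ}
    {w : E} {w' : E →L[ℝ] E} {b : E →L[ℝ] ℝ} {b' : E →L[ℝ] E →L[ℝ] ℝ}
    {ξ : E →L[ℝ] ℝ} (hξ : IsMixedCourantForm J q D v v' a a' w w' b b' ξ) :
    JetVectorTorsionFree J q D v v' a a' w w' b b' ξ := by
  refine SeparatingDual.eq_zero_of_forall_dual_eq_zero (R := ℝ) fun c => ?_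
  have e1 : c (q ξ) = -ξ (q c) := h.skew _ _
  have e2 : ∀ l : E →L[ℝ] ℝ, c (q l) = -l (q c) := fun l => h.skew _ _
  have e3 : ∀ l : E →L[ℝ] ℝ, c (J (q l)) = -l (J (q c)) := fun l => by
    rw [← h.comm, e2]; rfl
  rw [hξ] at e1
  simp only [jetCourantForm, map_add, map_sub, map_neg, add_apply, neg_apply,
    ContinuousLinearMap.comp_apply, hH v, hH w, e1, e2, e3, h.sq]
  linear_combination hT a b c - h.skew' (q b) a c - (1 / 2) * h.skew' (q c) a b
    + (1 / 2) * h.skew (a' (q c)) b - (1 / 2) * h.skew (b' (q c)) a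

/-- Here `P^♯` is differentiated only along the test vector `z` or `J z`, never along a vector `q
l`. Holomorphy alone is therefore enough. -/
theorem jetFormTorsionFree (h : BivectorJet J q D) (hH : JetHolomorphic J D)
    {v : E} {v' : E →L[ℝ] E} {a : E →L[ℝ] ℝ} {a' : E →L[ℝ] E →L[ℝ] ℝ}
    {w : E} {w' : E →L[ℝ] E} {b : E →L[ℝ] ℝ} {b' : E →L[ℝ] E →L[ℝ] ℝ}
    {ξ : E →L[ℝ] ℝ} (hξ : IsMixedCourantForm J q D v v' a a' w w' b b' ξ) :
    JetFormTorsionFree J q D v v' a a' w w' b b' ξ := by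
  intro z
  have e2 : ∀ l m : E →L[ℝ] ℝ, l (J (q m)) = -m (J (q l)) := fun l m => by
    rw [← h.comm, h.skew]; rfl
  rw [hξ]
  simp only [jetCourantForm, map_add, map_neg, add_apply, neg_apply,
    ContinuousLinearMap.comp_apply, hH z, h.sq]
  linear_combination (1 / 2) * e2 a (b' z) - (1 / 2) * e2 b (a' z)
    + (1 / 2) * h.skew (a' (J z)) b - (1 / 2) * h.skew (b' (J z)) a

theorem jetHolomorphic_and_jetPoisson (h : BivectorJet J q D)
    (hV : ∀ a b ξ, IsMixedCourantForm J q D 0 0 a 0 0 0 b 0 ξ →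
      JetVectorTorsionFree J q D 0 0 a 0 0 0 b 0 ξ)
    (hF : ∀ a b ξ, IsMixedCourantForm J q D 0 0 a 0 0 0 b 0 ξ →
      JetFormTorsionFree J q D 0 0 a 0 0 0 b 0 ξ) :
    JetHolomorphic J D ∧ JetPoisson q D := by
  -- For constant one-forms each of the two mixed brackets contributes half of `b (D z a)`, the
  -- second one after using skewness of `D z`.
  have hξ : ∀ a b, IsMixedCourantForm J q D 0 0 a 0 0 0 b 0 (b.comp (D.flip a)) := by
    intro a b z
    simp only [jetCourantForm, map_zero, zero_apply, add_zero, zero_add,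
      neg_apply, ContinuousLinearMap.comp_apply, ContinuousLinearMap.flip_apply]
    simp
    linear_combination (1 / 2) * h.skew' z b a
  constructor
  · intro z a
    refine (SeparatingDual.eq_iff_forall_dual_eq (R := ℝ)).2 fun b => ?_
    have := hF a b _ (hξ a b) z
    simp [jetCourantForm] at this
    have e3 : b (J (D z a)) = -a (J (D z b)) := by rw [← h.comm', h.skew']; rfl
    linear_combination this - (1 / 2) * e3
  · intro a b c
    have := congrArg c (hV a b _ (hξ a b))
    simp at this
    have e := h.skew (b.comp (D.flip a)) c
    simp at e
    linear_combination this + h.skew' (q b) c a + e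

/-- The value on `z` of `L_p b - L_r a - d(b(p))` for vector fields with values `p`, `r` and
derivatives `p'`, `r'`, and one-forms with values `a`, `b` and derivatives `a'`, `b'`. -/
def jetFormBracket (p : E) (p' : E → E) (a : E →L[ℝ] ℝ) (a' : E → E →L[ℝ] ℝ)
    (r : E) (r' : E → E) (b : E →L[ℝ] ℝ) (b' : E → E →L[ℝ] ℝ) (z : E) : ℝ :=
  (b' p z + b (p' z)) - (a' r z + a (r' z)) - (b' z p + b (p' z))

variable (J q D) in
/-- The compatibility of `[α, β]_{P_N}` and `[α, β]_P` at a point, for one-forms with values `a`,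
`b` and derivatives `a'`, `b'`. -/
def JetCompatible (a : E →L[ℝ] ℝ) (a' : E →L[ℝ] E →L[ℝ] ℝ)
    (b : E →L[ℝ] ℝ) (b' : E →L[ℝ] E →L[ℝ] ℝ) : Prop :=
  ∀ z, jetFormBracket (q (a.comp J)) (fun z => D z (a.comp J) + q ((a' z).comp J)) a a'
      (q (b.comp J)) (fun z => D z (b.comp J) + q ((b' z).comp J)) b b' z
    = jetFormBracket (q (a.comp J)) (fun z => D z (a.comp J) + q ((a' z).comp J))
        (a.comp J) (fun z => (a' z).comp J) (q b) (fun z => D z b + q (b' z)) b b' z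
      + jetFormBracket (q a) (fun z => D z a + q (a' z)) a a'
        (q (b.comp J)) (fun z => D z (b.comp J) + q ((b' z).comp J))
        (b.comp J) (fun z => (b' z).comp J) z
      - jetFormBracket (q a) (fun z => D z a + q (a' z)) a a'
        (q b) (fun z => D z b + q (b' z)) b b' (J z)

/-- The defect of compatibility is tensorial: `a'` and `b'` cancel by skewness of `q` and its
commutation with `J`. What survives is the difference between differentiating `P^♯` along `J z` and
applying `J` after differentiating along `z`. -/
theorem jetCompatible_iff (h : BivectorJet J q D) (a : E →L[ℝ] ℝ) (a' : E →L[ℝ] E →L[ℝ] ℝ)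
    (b : E →L[ℝ] ℝ) (b' : E →L[ℝ] E →L[ℝ] ℝ) :
    JetCompatible J q D a a' b b' ↔ ∀ z, b (D (J z) a) = b (J (D z a)) := by
  refine forall_congr' fun z => ?_
  have e2 : ∀ l m : E →L[ℝ] ℝ, l (J (q m)) = -m (J (q l)) := fun l m => by
    rw [← h.comm, h.skew]; rfl
  have e3 : b (J (D z a)) = -a (J (D z b)) := by rw [← h.comm', h.skew']; rfl
  simp only [jetFormBracket, h.comm, h.comm', map_add, ContinuousLinearMap.comp_apply]
  constructor
  · intro H
    linear_combination H - e2 a (b' z) + h.skew (b' (J z)) a + h.skew' (J z) a b - e3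
  · intro H
    linear_combination H + e2 a (b' z) - h.skew (b' (J z)) a - h.skew' (J z) a b + e3

end Jets

theorem chart_target_mem_nhds {H M : Type*} [TopologicalSpace H] [TopologicalSpace M]
    [ChartedSpace H M] (x₀ : M) : (chartAt H x₀).target ∈ 𝓝 (chartAt H x₀ x₀) :=
  (chartAt H x₀).open_target.mem_nhds (mem_chart_target H x₀)

/-! ### Pairings, Lie derivatives and Courant brackets in coordinates -/

section Sections

variable {E : Type*} [NormedAddCommGroup E] [NormedSpace ℝ E]
  {M : Type*} [TopologicalSpace M] [ChartedSpace E M]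

theorem contDiffAt_covectorInChart [IsManifold 𝓘(ℝ, E) ∞ M] {α : ∀ x : M, Cotan (E := E) ℝ x}
    (hα : SmoothOneForm α) (x₀ : M) :
    ContDiffAt ℝ ∞ (covectorInChart x₀ α) (chartAt E x₀ x₀) := by
  rw [← oneFormInChart_eq]
  exact smoothOneForm_iff.1 hα x₀

theorem SmoothVectorField.contDiffAt [IsManifold 𝓘(ℝ, E) ∞ M] {V : ∀ x : M, Tan (E := E) x}
    (hV : SmoothVectorField V) (x₀ : M) :
    ContDiffAt ℝ ∞ (vectorFieldInChart x₀ V) (chartAt E x₀ x₀) :=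
  smoothVectorField_iff.1 hV x₀

theorem covectorInChart_vectorFieldInChart [IsManifold 𝓘(ℝ, E) ∞ M] (x₀ : M) {y : E}
    (hy : y ∈ (chartAt E x₀).target) (α : ∀ x : M, Cotan (E := E) ℝ x)
    (V : ∀ x : M, Tan (E := E) x) :
    covectorInChart x₀ α y (vectorFieldInChart x₀ V y)
      = α ((chartAt E x₀).symm y) (V ((chartAt E x₀).symm y)) := by
  have h := fun v => DFunLike.congr_fun (frame_comp_coframe x₀ hy) v
  rw [vectorFieldInChart_apply x₀ V hy]
  exact congrArg (modelCovector (α ((chartAt E x₀).symm y))) (h _)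

/-- The derivative of the pairing of a one-form with a vector field. -/
theorem differential_pairing [IsManifold 𝓘(ℝ, E) ∞ M] {α : ∀ x : M, Cotan (E := E) ℝ x}
    (hα : SmoothOneForm α) {V : ∀ x : M, Tan (E := E) x} (hV : SmoothVectorField V) (x₀ : M) :
    MDifferentiableAt 𝓘(ℝ, E) 𝓘(ℝ, ℝ) (fun x => α x (V x)) x₀ ∧
      ∀ z : E, modelCovector (differential (fun x => α x (V x)) x₀) z
        = fderiv ℝ (covectorInChart x₀ α) (chartAt E x₀ x₀) z (vectorFieldInChart x₀ V (chartAt E x₀ x₀))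
          + covectorInChart x₀ α (chartAt E x₀ x₀)
            (fderiv ℝ (vectorFieldInChart x₀ V) (chartAt E x₀ x₀) z) := by
  have hα' := contDiffAt_covectorInChart hα x₀
  have hV' := hV.contDiffAt x₀
  have hev : (fun x => α x (V x)) ∘ (chartAt E x₀).symm =ᶠ[𝓝 (chartAt E x₀ x₀)]
      fun y => covectorInChart x₀ α y (vectorFieldInChart x₀ V y) := by
    filter_upwards [chart_target_mem_nhds x₀] with y hy
    exact (covectorInChart_vectorFieldInChart x₀ hy α V).symm
  have hd : MDifferentiableAt 𝓘(ℝ, E) 𝓘(ℝ, ℝ) (fun x => α x (V x)) x₀ :=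
    (contMDiffAt_iff_comp_chartAt_symm.2
      ((contDiffAt_congr_iff hev).2 (hα'.clm_apply hV'))).mdifferentiableAt (by simp)
  refine ⟨hd, fun z => ?_⟩
  rw [differential_eq_fderiv hd, hev.fderiv_eq]
  unfold modelCovector
  rw [fderiv_clm_apply (hα'.differentiableAt (by simp)) (hV'.differentiableAt (by simp))]
  simp [add_comm]

theorem courantBracket_fst [IsManifold 𝓘(ℝ, E) ∞ M] (u v : ∀ x : M, GenTan (E := E) x)
    (x₀ : M) : (courantBracket u v x₀).1 =
      fderiv ℝ (vectorFieldInChart x₀ fun x => (v x).1) (chartAt E x₀ x₀)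
          (vectorFieldInChart x₀ (fun x => (u x).1) (chartAt E x₀ x₀))
        - fderiv ℝ (vectorFieldInChart x₀ fun x => (u x).1) (chartAt E x₀ x₀)
          (vectorFieldInChart x₀ (fun x => (v x).1) (chartAt E x₀ x₀)) :=
  mlieBracket_eq_lieBracket _ _ _

theorem lieDerivative_apply [IsManifold 𝓘(ℝ, E) ∞ M] (V : ∀ x : M, Tan (E := E) x)
    (β : ∀ x : M, Cotan (E := E) ℝ x) (x₀ : M) (z : E) :
    modelCovector (lieDerivative V β x₀) z
      = fderiv ℝ (covectorInChart x₀ β) (chartAt E x₀ x₀)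
          (vectorFieldInChart x₀ V (chartAt E x₀ x₀)) z
        + covectorInChart x₀ β (chartAt E x₀ x₀)
          (fderiv ℝ (vectorFieldInChart x₀ V) (chartAt E x₀ x₀) z) := by
  rw [lieDerivative_eq, oneFormInChart_eq]
  rfl

theorem courantBracket_snd_apply [IsManifold 𝓘(ℝ, E) ∞ M] {u v : ∀ x : M, GenTan (E := E) x}
    (hu : SmoothGenSection u) (hv : SmoothGenSection v) (x₀ : M) (z : E) :
    modelCovector (courantBracket u v x₀).2 z = jetCourantForm
      (vectorFieldInChart x₀ (fun x => (u x).1) (chartAt E x₀ x₀))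
      (fderiv ℝ (vectorFieldInChart x₀ fun x => (u x).1) (chartAt E x₀ x₀))
      (covectorInChart x₀ (fun x => (u x).2) (chartAt E x₀ x₀))
      (fderiv ℝ (covectorInChart x₀ fun x => (u x).2) (chartAt E x₀ x₀))
      (vectorFieldInChart x₀ (fun x => (v x).1) (chartAt E x₀ x₀))
      (fderiv ℝ (vectorFieldInChart x₀ fun x => (v x).1) (chartAt E x₀ x₀))
      (covectorInChart x₀ (fun x => (v x).2) (chartAt E x₀ x₀))
      (fderiv ℝ (covectorInChart x₀ fun x => (v x).2) (chartAt E x₀ x₀)) z := by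
  obtain ⟨h1, h2⟩ := differential_pairing hu.2 hv.1 x₀
  obtain ⟨h3, h4⟩ := differential_pairing hv.2 hu.1 x₀
  have h5 : differential (E := E) (fun y => (u y).2 (v y).1 - (v y).2 (u y).1) x₀
      = differential (E := E) (fun y => (u y).2 (v y).1) x₀
        - differential (E := E) (fun y => (v y).2 (u y).1) x₀ :=
    (h1.hasMFDerivAt.sub h3.hasMFDerivAt).mfderiv
  have h6 : modelCovector (courantBracket u v x₀).2 z =
      modelCovector (lieDerivative (fun y => (u y).1) (fun y => (v y).2) x₀) z
      - modelCovector (lieDerivative (fun y => (v y).1) (fun y => (u y).2) x₀) z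
      + 1 / 2 * (modelCovector (differential (fun y => (u y).2 (v y).1) x₀) z
        - modelCovector (differential (fun y => (v y).2 (u y).1) x₀) z) := by
    unfold courantBracket
    rw [h5]
    rfl
  rw [h6, h2, h4, lieDerivative_apply, lieDerivative_apply, jetCourantForm]

end Sections

/-! ### The map `P^♯` in coordinates -/

section SharpCharts

variable {E : Type*} [NormedAddCommGroup E] [NormedSpace ℝ E] [FiniteDimensional ℝ E]
  {M : Type*} [TopologicalSpace M] [ChartedSpace E M]

variable (E) in
/-- The inverse of the canonical map from `E` to its double dual. -/
def doubleDualInv : ((E →L[ℝ] ℝ) →L[ℝ] ℝ) →L[ℝ] E :=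
  LinearMap.toContinuousLinearMap ((Module.evalEquiv ℝ E).symm.toLinearMap.comp
    ({ toFun := fun ξ => ξ.toLinearMap.comp
        (LinearMap.toContinuousLinearMap : (E →ₗ[ℝ] ℝ) ≃ₗ[ℝ] (E →L[ℝ] ℝ)).toLinearMap
       map_add' := fun _ _ => rfl
       map_smul' := fun _ _ => rfl } :
      ((E →L[ℝ] ℝ) →L[ℝ] ℝ) →ₗ[ℝ] Module.Dual ℝ (Module.Dual ℝ E)))

theorem apply_doubleDualInv (ξ : (E →L[ℝ] ℝ) →L[ℝ] ℝ) (m : E →L[ℝ] ℝ) :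
    m (doubleDualInv E ξ) = ξ m :=
  Module.apply_evalEquiv_symm_apply ℝ E (m : E →ₗ[ℝ] ℝ) _

/-- The coordinate expression of `P^♯` in the preferred chart at `x₀`. -/
def sharpInChart (P : BivectorField E M ℝ) (x₀ : M) (y : E) : (E →L[ℝ] ℝ) →L[ℝ] E :=
  (doubleDualInv E).comp (bivectorInChart P x₀ y)

theorem apply_sharpInChart (P : BivectorField E M ℝ) (x₀ : M) (y : E) (l m : E →L[ℝ] ℝ) :
    m (sharpInChart P x₀ y l) = bivectorInChart P x₀ y l m :=
  apply_doubleDualInv _ _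

theorem apply_sharpInChart_swap (P : BivectorField E M ℝ) (x₀ : M) (y : E)
    (l m : E →L[ℝ] ℝ) : m (sharpInChart P x₀ y l) = -l (sharpInChart P x₀ y m) := by
  rw [apply_sharpInChart, apply_sharpInChart, bivectorInChart_swap]

theorem contDiffAt_sharpInChart [IsManifold 𝓘(ℝ, E) ∞ M] (P : BivectorField E M ℝ) (x₀ : M) :
    ContDiffAt ℝ ∞ (sharpInChart P x₀) (chartAt E x₀ x₀) :=
  contDiffAt_const.clm_comp (contDiffAt_bivectorInChart P x₀)

theorem sharpInChart_eq_coframe [IsManifold 𝓘(ℝ, E) ∞ M] (P : BivectorField E M ℝ) (x₀ : M)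
    {y : E} (hy : y ∈ (chartAt E x₀).target) (α : ∀ x : M, Cotan (E := E) ℝ x) :
    sharpInChart P x₀ y (covectorInChart x₀ α y)
      = coframe x₀ y (sharp (P.toFun ((chartAt E x₀).symm y)) (α ((chartAt E x₀).symm y))) := by
  refine (SeparatingDual.eq_iff_forall_dual_eq (R := ℝ)).2 fun m => ?_
  rw [apply_sharpInChart]
  let m' : E →L[ℝ] ℝ := m.comp (coframe x₀ y)
  have h := apply_sharp (P.toFun ((chartAt E x₀).symm y)) (α ((chartAt E x₀).symm y)) m'
  refine Eq.trans ?_ h.symm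
  rw [bivectorInChart_apply, covectorInChart, ContinuousLinearMap.comp_assoc,
    frame_comp_coframe x₀ hy]
  rfl

theorem vectorFieldInChart_sharp [IsManifold 𝓘(ℝ, E) ∞ M] (P : BivectorField E M ℝ) (x₀ : M)
    {y : E} (hy : y ∈ (chartAt E x₀).target) (α : ∀ x : M, Cotan (E := E) ℝ x) :
    vectorFieldInChart x₀ (fun x => sharp (P.toFun x) (α x)) y
      = sharpInChart P x₀ y (covectorInChart x₀ α y) := by
  rw [vectorFieldInChart_apply x₀ _ hy, sharpInChart_eq_coframe P x₀ hy]

end SharpCharts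

/-! ### Tensors of type (1,1) with constant coefficients -/

section ConstantTensor

variable {E : Type*} [NormedAddCommGroup E] [NormedSpace ℝ E]
  {M : Type*} [TopologicalSpace M] [ChartedSpace E M]

/-- A `(1,1)`-tensor which has the constant coefficients `J` in the preferred charts. -/
def ConstantInCharts (N : ∀ x : M, Tan (E := E) x →L[ℝ] Tan (E := E) x) (J : E →L[ℝ] E) : Prop :=
  ∀ (x₀ : M) (y : E), y ∈ (chartAt E x₀).target → ∀ v : E,
    coframe x₀ y (N ((chartAt E x₀).symm y) v) = J (coframe x₀ y v)

variable {N : ∀ x : M, Tan (E := E) x →L[ℝ] Tan (E := E) x} {J : E →L[ℝ] E}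

theorem ConstantInCharts.apply_eq [IsManifold 𝓘(ℝ, E) ∞ M] (hN : ConstantInCharts N J) (x : M)
    (v : E) : N x v = J v := by
  have h := hN x _ (mem_chart_target E x) v
  rw [(chartAt E x).left_inv (mem_chart_source E x), coframe_self] at h
  exact h

theorem ConstantInCharts.vectorFieldInChart [IsManifold 𝓘(ℝ, E) ∞ M]
    (hN : ConstantInCharts N J) (x₀ : M) {y : E} (hy : y ∈ (chartAt E x₀).target)
    (V : ∀ x : M, Tan (E := E) x) :
    vectorFieldInChart x₀ (fun x => N x (V x)) y = J (vectorFieldInChart x₀ V y) := by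
  rw [vectorFieldInChart_apply x₀ _ hy, vectorFieldInChart_apply x₀ _ hy]
  exact hN x₀ y hy _

theorem ConstantInCharts.frame_comp [IsManifold 𝓘(ℝ, E) ∞ M]
    (hN : ConstantInCharts N J) (x₀ : M) {y : E} (hy : y ∈ (chartAt E x₀).target) (w : E) :
    N ((chartAt E x₀).symm y) (frame x₀ y w) = frame x₀ y (J w) := by
  have h1 := hN x₀ y hy (frame x₀ y w)
  have h2 : coframe x₀ y (frame x₀ y w) = w := DFunLike.congr_fun (coframe_comp_frame x₀ hy) w
  have h3 : frame x₀ y (coframe x₀ y (N ((chartAt E x₀).symm y) (frame x₀ y w)))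
      = N ((chartAt E x₀).symm y) (frame x₀ y w) :=
    DFunLike.congr_fun (frame_comp_coframe x₀ hy) (N ((chartAt E x₀).symm y) (frame x₀ y w))
  rw [← h3, h1, h2]

theorem ConstantInCharts.covectorInChart [IsManifold 𝓘(ℝ, E) ∞ M]
    (hN : ConstantInCharts N J) (x₀ : M) {y : E} (hy : y ∈ (chartAt E x₀).target)
    (α : ∀ x : M, Cotan (E := E) ℝ x) :
    covectorInChart x₀ (fun x => (α x).comp (N x)) y = (covectorInChart x₀ α y).comp J := by
  ext w
  exact congrArg (modelCovector (α ((chartAt E x₀).symm y))) (hN.frame_comp x₀ hy w)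

theorem ConstantInCharts.smoothVectorField [IsManifold 𝓘(ℝ, E) ∞ M]
    (hN : ConstantInCharts N J) {V : ∀ x : M, Tan (E := E) x} (hV : SmoothVectorField V) :
    SmoothVectorField fun x => N x (V x) := by
  rw [smoothVectorField_iff]
  intro x₀
  refine (contDiffAt_congr_iff ?_).2 (J.contDiff.contDiffAt.comp _ (hV.contDiffAt x₀))
  filter_upwards [chart_target_mem_nhds x₀] with y hy
  exact hN.vectorFieldInChart x₀ hy V

theorem ConstantInCharts.fderiv_vectorFieldInChart [IsManifold 𝓘(ℝ, E) ∞ M]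
    (hN : ConstantInCharts N J) {V : ∀ x : M, Tan (E := E) x} (hV : SmoothVectorField V)
    (x₀ : M) :
    fderiv ℝ (HolPoisson.vectorFieldInChart x₀ fun x => N x (V x)) (chartAt E x₀ x₀)
      = J.comp (fderiv ℝ (HolPoisson.vectorFieldInChart x₀ V) (chartAt E x₀ x₀)) := by
  have hev : HolPoisson.vectorFieldInChart x₀ (fun x => N x (V x)) =ᶠ[𝓝 (chartAt E x₀ x₀)]
      fun y => J (HolPoisson.vectorFieldInChart x₀ V y) := by
    filter_upwards [chart_target_mem_nhds x₀] with y hy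
    exact hN.vectorFieldInChart x₀ hy V
  rw [hev.fderiv_eq]
  exact (J.hasFDerivAt.comp _
    ((hV.contDiffAt x₀).differentiableAt (by simp)).hasFDerivAt).fderiv

theorem ConstantInCharts.smoothOneForm [IsManifold 𝓘(ℝ, E) ∞ M]
    (hN : ConstantInCharts N J) {α : ∀ x : M, Cotan (E := E) ℝ x} (hα : SmoothOneForm α) :
    SmoothOneForm fun x => (α x).comp (N x) := by
  rw [smoothOneForm_iff]
  intro x₀
  rw [oneFormInChart_eq]
  refine (contDiffAt_congr_iff ?_).2
    ((contDiffAt_covectorInChart hα x₀).clm_comp (contDiffAt_const (c := J)))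
  filter_upwards [chart_target_mem_nhds x₀] with y hy
  exact hN.covectorInChart x₀ hy α

theorem ConstantInCharts.fderiv_covectorInChart [IsManifold 𝓘(ℝ, E) ∞ M]
    (hN : ConstantInCharts N J) {α : ∀ x : M, Cotan (E := E) ℝ x} (hα : SmoothOneForm α)
    (x₀ : M) (z : E) :
    fderiv ℝ (HolPoisson.covectorInChart x₀ fun x => (α x).comp (N x)) (chartAt E x₀ x₀) z
      = (fderiv ℝ (HolPoisson.covectorInChart x₀ α) (chartAt E x₀ x₀) z).comp J := by
  have hev : HolPoisson.covectorInChart x₀ (fun x => (α x).comp (N x)) =ᶠ[𝓝 (chartAt E x₀ x₀)]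
      fun y => (HolPoisson.covectorInChart x₀ α y).comp J := by
    filter_upwards [chart_target_mem_nhds x₀] with y hy
    exact hN.covectorInChart x₀ hy α
  have h := ((contDiffAt_covectorInChart hα x₀).differentiableAt (by simp))
  rw [hev.fderiv_eq, fderiv_clm_comp h (differentiableAt_const J)]
  ext w
  simp

/-- Since `J` is constant, only derivatives of `V` and `W` occur in the torsion, and `J² = -1` makes
them cancel in pairs. -/
theorem ConstantInCharts.isNijenhuisTensor [IsManifold 𝓘(ℝ, E) ∞ M]
    (hN : ConstantInCharts N J) (hJ : ∀ v, J (J v) = -v) : IsNijenhuisTensor N where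
  smooth _ hV := hN.smoothVectorField hV
  torsion V W hV hW x := by
    simp only [mlieBracket_eq_lieBracket, VectorField.lieBracket_eq,
      hN.fderiv_vectorFieldInChart hV, hN.fderiv_vectorFieldInChart hW,
      hN.vectorFieldInChart x (mem_chart_target E x)]
    have key : ∀ v : E, N x v = J v := hN.apply_eq x
    have alg : ∀ (A B : E →L[ℝ] E) (v w : E), (J.comp B) (J v) - (J.comp A) (J w)
        - J ((B (J v) - (J.comp A) w) + ((J.comp B) v - A (J w)) - J (B v - A w)) = 0 := by
      intro A B v w
      simp only [ContinuousLinearMap.comp_apply, map_add, map_sub, hJ]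
      abel
    -- Each tangent space is the model space by definition; the subtraction is read there so that `N
    -- x` can be replaced by `J`.
    refine Eq.trans (congrArg (HSub.hSub (α := E) (β := E) _) (key _)) ?_
    rw [key]
    exact alg _ _ _ _

theorem SmoothVectorField.add [IsManifold 𝓘(ℝ, E) ∞ M] {V W : ∀ x : M, Tan (E := E) x} (hV : SmoothVectorField V)
    (hW : SmoothVectorField W) : SmoothVectorField fun x => V x + W x := by
  intro x
  exact ContMDiffAt.add_section (hV x) (hW x)

theorem vectorFieldInChart_add {V W : ∀ x : M, Tan (E := E) x} (x₀ : M) :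
    vectorFieldInChart x₀ (fun x => V x + W x)
      = fun y => vectorFieldInChart x₀ V y + vectorFieldInChart x₀ W y := by
  ext y
  exact map_add _ _ _

end ConstantTensor

/-! ### Smoothness and derivatives of `P^♯ α` -/

section SharpSections

variable {E : Type*} [NormedAddCommGroup E] [NormedSpace ℝ E] [FiniteDimensional ℝ E]
  {M : Type*} [TopologicalSpace M] [ChartedSpace E M] [IsManifold 𝓘(ℝ, E) ∞ M]

theorem SmoothOneForm.smoothVectorField_sharp (P : BivectorField E M ℝ)
    {α : ∀ x : M, Cotan (E := E) ℝ x} (hα : SmoothOneForm α) :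
    SmoothVectorField fun x => sharp (P.toFun x) (α x) := by
  rw [smoothVectorField_iff]
  intro x₀
  refine (contDiffAt_congr_iff ?_).2
    ((contDiffAt_sharpInChart P x₀).clm_apply (contDiffAt_covectorInChart hα x₀))
  filter_upwards [chart_target_mem_nhds x₀] with y hy
  exact vectorFieldInChart_sharp P x₀ hy α

theorem fderiv_vectorFieldInChart_sharp (P : BivectorField E M ℝ)
    {α : ∀ x : M, Cotan (E := E) ℝ x} (hα : SmoothOneForm α) (x₀ : M) (z : E) :
    fderiv ℝ (vectorFieldInChart x₀ fun x => sharp (P.toFun x) (α x)) (chartAt E x₀ x₀) z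
      = fderiv ℝ (sharpInChart P x₀) (chartAt E x₀ x₀) z
          (covectorInChart x₀ α (chartAt E x₀ x₀))
        + sharpInChart P x₀ (chartAt E x₀ x₀)
          (fderiv ℝ (covectorInChart x₀ α) (chartAt E x₀ x₀) z) := by
  have hev : vectorFieldInChart x₀ (fun x => sharp (P.toFun x) (α x))
      =ᶠ[𝓝 (chartAt E x₀ x₀)] fun y => sharpInChart P x₀ y (covectorInChart x₀ α y) := by
    filter_upwards [chart_target_mem_nhds x₀] with y hy
    exact vectorFieldInChart_sharp P x₀ hy α
  rw [hev.fderiv_eq, fderiv_clm_apply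
    ((contDiffAt_sharpInChart P x₀).differentiableAt (by simp))
    ((contDiffAt_covectorInChart hα x₀).differentiableAt (by simp))]
  simp [add_comm]

variable {N : ∀ x : M, Tan (E := E) x →L[ℝ] Tan (E := E) x} {J : E →L[ℝ] E}

theorem ConstantInCharts.smoothGenSection (hN : ConstantInCharts N J) (P : BivectorField E M ℝ)
    {u : ∀ x : M, GenTan (E := E) x} (hu : SmoothGenSection u) :
    SmoothGenSection fun x => genMatrix P N x (u x) := by
  refine ⟨(hN.smoothVectorField hu.1).add (hu.2.smoothVectorField_sharp P), ?_⟩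
  have h := hN.smoothOneForm hu.2
  rw [smoothOneForm_iff] at h ⊢
  exact fun x₀ => (h x₀).neg

end SharpSections

section ZeroField

variable {E : Type*} [NormedAddCommGroup E] [NormedSpace ℝ E]
  {M : Type*} [TopologicalSpace M] [ChartedSpace E M]

theorem vectorFieldInChart_zero (x₀ : M) :
    vectorFieldInChart x₀ (fun x : M => (0 : Tan (E := E) x)) = fun _ => 0 := by
  ext y
  exact map_zero _

theorem SmoothVectorField.zero [IsManifold 𝓘(ℝ, E) ∞ M] :
    SmoothVectorField (fun x : M => (0 : Tan (E := E) x)) := by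
  rw [smoothVectorField_iff]
  intro x₀
  rw [vectorFieldInChart_zero]
  exact contDiffAt_const

end ZeroField

/-! ### Integrability of the block matrix as a condition on jets -/

section GeneralizedComplex

variable {E : Type*} [NormedAddCommGroup E] [NormedSpace ℝ E] [FiniteDimensional ℝ E]
  {M : Type*} [TopologicalSpace M] [ChartedSpace E M] [IsManifold 𝓘(ℝ, E) ∞ M]
  {N : ∀ x : M, Tan (E := E) x →L[ℝ] Tan (E := E) x} {J : E →L[ℝ] E}
  {P : BivectorField E M ℝ}

theorem hasFDerivAt_sharpInChart (P : BivectorField E M ℝ) (x₀ : M) :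
    HasFDerivAt (sharpInChart P x₀) (fderiv ℝ (sharpInChart P x₀) (chartAt E x₀ x₀))
      (chartAt E x₀ x₀) :=
  ((contDiffAt_sharpInChart P x₀).differentiableAt (by simp)).hasFDerivAt

theorem ConstantInCharts.sharpInChart_comp (hN : ConstantInCharts N J)
    (hcomm : ∀ (x : M) (α : Cotan (E := E) ℝ x),
      N x (sharp (P.toFun x) α) = sharp (P.toFun x) (α.comp (N x)))
    (x₀ : M) {y : E} (hy : y ∈ (chartAt E x₀).target) (l : E →L[ℝ] ℝ) :
    sharpInChart P x₀ y (l.comp J) = J (sharpInChart P x₀ y l) := by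
  -- The form with constant coefficients `l` in the chart at `x₀`. Only its value at the point with
  -- coordinates `y` matters, so its behaviour outside the chart is irrelevant.
  let α : ∀ x : M, Cotan (E := E) ℝ x := fun x =>
    (l.comp (show E →L[ℝ] E from chartDifferential (chartAt E x₀) x) : E →L[ℝ] ℝ)
  have hα : HolPoisson.covectorInChart x₀ α y = l := by
    change (l.comp (coframe x₀ y)).comp (frame x₀ y) = l
    rw [ContinuousLinearMap.comp_assoc, coframe_comp_frame x₀ hy]
    rfl
  have h1 := hN.covectorInChart x₀ hy α
  have h2 := sharpInChart_eq_coframe P x₀ hy fun x => (α x).comp (N x)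
  have h3 := sharpInChart_eq_coframe P x₀ hy α
  rw [h1, hα, ← hcomm] at h2
  rw [hα] at h3
  rw [h2, h3]
  exact hN x₀ y hy _

/-- Skewness and commutation with `J` hold on a whole neighbourhood in the chart, where `J` is
constant. Differentiating these linear identities gives the same identities for the derivative. -/
theorem ConstantInCharts.bivectorJet (hN : ConstantInCharts N J) (hJ : ∀ v, J (J v) = -v)
    (hcomm : ∀ (x : M) (α : Cotan (E := E) ℝ x),
      N x (sharp (P.toFun x) α) = sharp (P.toFun x) (α.comp (N x))) (x₀ : M) :
    BivectorJet J (sharpInChart P x₀ (chartAt E x₀ x₀))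
      (fderiv ℝ (sharpInChart P x₀) (chartAt E x₀ x₀)) := by
  have hD := hasFDerivAt_sharpInChart P x₀
  have hDl : ∀ l : E →L[ℝ] ℝ, HasFDerivAt (fun y => sharpInChart P x₀ y l)
      ((ContinuousLinearMap.apply ℝ E l).comp
        (fderiv ℝ (sharpInChart P x₀) (chartAt E x₀ x₀))) (chartAt E x₀ x₀) := fun l =>
    (ContinuousLinearMap.apply ℝ E l).hasFDerivAt.comp _ hD
  refine ⟨hJ, apply_sharpInChart_swap P x₀ _,
    hN.sharpInChart_comp hcomm x₀ (mem_chart_target E x₀), fun z l m => ?_, fun z l => ?_⟩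
  · have h1 := m.hasFDerivAt.comp _ (hDl l)
    have h2 := (l.hasFDerivAt.comp _ (hDl m)).neg
    have h3 : (m ∘ fun y => sharpInChart P x₀ y l) = -(l ∘ fun y => sharpInChart P x₀ y m) :=
      funext fun y => apply_sharpInChart_swap P x₀ y l m
    rw [h3] at h1
    exact DFunLike.congr_fun (h1.unique h2) z
  · have h1 := hDl (l.comp J)
    have h2 := J.hasFDerivAt.comp _ (hDl l)
    have h3 : (fun y => sharpInChart P x₀ y (l.comp J)) =ᶠ[𝓝 (chartAt E x₀ x₀)]
        J ∘ fun y => sharpInChart P x₀ y l := by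
      filter_upwards [chart_target_mem_nhds x₀] with y hy
      exact hN.sharpInChart_comp hcomm x₀ hy l
    exact DFunLike.congr_fun (h1.unique (h2.congr_of_eventuallyEq h3)) z

section Torsion

/-- The Courant torsion of `[[N, P^♯], [0, -N^*]]` (with square `-1`) on two sections. -/
def courantTorsion (P : BivectorField E M ℝ)
    (N : ∀ x : M, Tan (E := E) x →L[ℝ] Tan (E := E) x) (u v : ∀ x : M, GenTan (E := E) x) (x : M) : GenTan (E := E) x :=
  courantBracket (fun y => genMatrix P N y (u y)) (fun y => genMatrix P N y (v y)) x
    - courantBracket u v x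
    - genMatrix P N x (courantBracket (fun y => genMatrix P N y (u y)) v x
        + courantBracket u (fun y => genMatrix P N y (v y)) x)

/-- The form part of `[𝒥u, v] + [u, 𝒥v]`. -/
def mixedCourantForm (P : BivectorField E M ℝ)
    (N : ∀ x : M, Tan (E := E) x →L[ℝ] Tan (E := E) x) (u v : ∀ x : M, GenTan (E := E) x) (x : M) : E →L[ℝ] ℝ :=
  modelCovector (courantBracket (fun y => genMatrix P N y (u y)) v x
        + courantBracket u (fun y => genMatrix P N y (v y)) x).2

/-- This is the product rule; as `N` has constant coefficients, `P^♯` is the only block that is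
itself differentiated. The formulas are the substitutions built into the jet conditions. -/
theorem ConstantInCharts.genMatrix_inChart (hN : ConstantInCharts N J) (P : BivectorField E M ℝ)
    {u : ∀ x : M, GenTan (E := E) x} (hu : SmoothGenSection u) (x₀ : M) :
    HolPoisson.vectorFieldInChart x₀ (fun x => (genMatrix P N x (u x)).1) (chartAt E x₀ x₀)
        = J (HolPoisson.vectorFieldInChart x₀ (fun x => (u x).1) (chartAt E x₀ x₀))
          + sharpInChart P x₀ (chartAt E x₀ x₀)
            (HolPoisson.covectorInChart x₀ (fun x => (u x).2) (chartAt E x₀ x₀)) ∧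
      (∀ z, fderiv ℝ (HolPoisson.vectorFieldInChart x₀ fun x => (genMatrix P N x (u x)).1)
          (chartAt E x₀ x₀) z
        = J (fderiv ℝ (HolPoisson.vectorFieldInChart x₀ fun x => (u x).1) (chartAt E x₀ x₀) z)
          + (fderiv ℝ (sharpInChart P x₀) (chartAt E x₀ x₀) z
            (HolPoisson.covectorInChart x₀ (fun x => (u x).2) (chartAt E x₀ x₀))
          + sharpInChart P x₀ (chartAt E x₀ x₀)
            (fderiv ℝ (HolPoisson.covectorInChart x₀ fun x => (u x).2) (chartAt E x₀ x₀) z))) ∧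
      HolPoisson.covectorInChart x₀ (fun x => (genMatrix P N x (u x)).2) (chartAt E x₀ x₀)
        = -(HolPoisson.covectorInChart x₀ (fun x => (u x).2) (chartAt E x₀ x₀)).comp J ∧
      (∀ z, fderiv ℝ (HolPoisson.covectorInChart x₀ fun x => (genMatrix P N x (u x)).2)
          (chartAt E x₀ x₀) z
        = -(fderiv ℝ (HolPoisson.covectorInChart x₀ fun x => (u x).2)
            (chartAt E x₀ x₀) z).comp J) := by
  have e1 : HolPoisson.vectorFieldInChart x₀ (fun x => (genMatrix P N x (u x)).1) = fun y =>
      HolPoisson.vectorFieldInChart x₀ (fun x => N x (u x).1) y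
        + HolPoisson.vectorFieldInChart x₀ (fun x => sharp (P.toFun x) (u x).2) y :=
    vectorFieldInChart_add x₀
  have e2 : HolPoisson.covectorInChart x₀ (fun x => (genMatrix P N x (u x)).2) = fun y =>
      -HolPoisson.covectorInChart x₀ (fun x => (u x).2.comp (N x)) y := by
    ext y z
    rfl
  have d1 := ((hN.smoothVectorField hu.1).contDiffAt x₀).differentiableAt (n := ∞) (by simp)
  have d2 := ((hu.2.smoothVectorField_sharp P).contDiffAt x₀).differentiableAt (n := ∞) (by simp)
  have hy := mem_chart_target E x₀
  refine ⟨?_, fun z => ?_, ?_, fun z => ?_⟩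
  · rw [e1]
    simp only [hN.vectorFieldInChart x₀ hy, vectorFieldInChart_sharp P x₀ hy]
  · rw [e1, fderiv_fun_add d1 d2, hN.fderiv_vectorFieldInChart hu.1, add_apply,
      fderiv_vectorFieldInChart_sharp P hu.2]
    rfl
  · rw [e2]
    simp only [hN.covectorInChart x₀ hy]
  · rw [e2, fderiv_fun_neg, neg_apply, hN.fderiv_covectorInChart hu.2]

theorem ConstantInCharts.isMixedCourantForm (hN : ConstantInCharts N J)
    {u v : ∀ x : M, GenTan (E := E) x} (hu : SmoothGenSection u) (hv : SmoothGenSection v)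
    (x₀ : M) :
    IsMixedCourantForm J (sharpInChart P x₀ (chartAt E x₀ x₀))
      (fderiv ℝ (sharpInChart P x₀) (chartAt E x₀ x₀))
      (HolPoisson.vectorFieldInChart x₀ (fun x => (u x).1) (chartAt E x₀ x₀))
      (fderiv ℝ (HolPoisson.vectorFieldInChart x₀ fun x => (u x).1) (chartAt E x₀ x₀))
      (HolPoisson.covectorInChart x₀ (fun x => (u x).2) (chartAt E x₀ x₀))
      (fderiv ℝ (HolPoisson.covectorInChart x₀ fun x => (u x).2) (chartAt E x₀ x₀))
      (HolPoisson.vectorFieldInChart x₀ (fun x => (v x).1) (chartAt E x₀ x₀))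
      (fderiv ℝ (HolPoisson.vectorFieldInChart x₀ fun x => (v x).1) (chartAt E x₀ x₀))
      (HolPoisson.covectorInChart x₀ (fun x => (v x).2) (chartAt E x₀ x₀))
      (fderiv ℝ (HolPoisson.covectorInChart x₀ fun x => (v x).2) (chartAt E x₀ x₀))
      (mixedCourantForm P N u v x₀) := by
  obtain ⟨u1, u2, u3, u4⟩ := hN.genMatrix_inChart P hu x₀
  obtain ⟨v1, v2, v3, v4⟩ := hN.genMatrix_inChart P hv x₀
  intro z
  have h1 := courantBracket_snd_apply (hN.smoothGenSection P hu) hv x₀ z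
  have h2 := courantBracket_snd_apply hu (hN.smoothGenSection P hv) x₀ z
  rw [u1, u3, funext u2, funext u4] at h1
  rw [v1, v3, funext v2, funext v4] at h2
  rw [← h1, ← h2]
  rfl

theorem ConstantInCharts.courantTorsion_fst (hN : ConstantInCharts N J)
    {u v : ∀ x : M, GenTan (E := E) x} (hu : SmoothGenSection u) (hv : SmoothGenSection v)
    (x₀ : M) :
    (courantTorsion P N u v x₀).1 = 0 ↔
    JetVectorTorsionFree J (sharpInChart P x₀ (chartAt E x₀ x₀))
      (fderiv ℝ (sharpInChart P x₀) (chartAt E x₀ x₀))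
      (HolPoisson.vectorFieldInChart x₀ (fun x => (u x).1) (chartAt E x₀ x₀))
      (fderiv ℝ (HolPoisson.vectorFieldInChart x₀ fun x => (u x).1) (chartAt E x₀ x₀))
      (HolPoisson.covectorInChart x₀ (fun x => (u x).2) (chartAt E x₀ x₀))
      (fderiv ℝ (HolPoisson.covectorInChart x₀ fun x => (u x).2) (chartAt E x₀ x₀))
      (HolPoisson.vectorFieldInChart x₀ (fun x => (v x).1) (chartAt E x₀ x₀))
      (fderiv ℝ (HolPoisson.vectorFieldInChart x₀ fun x => (v x).1) (chartAt E x₀ x₀))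
      (HolPoisson.covectorInChart x₀ (fun x => (v x).2) (chartAt E x₀ x₀))
      (fderiv ℝ (HolPoisson.covectorInChart x₀ fun x => (v x).2) (chartAt E x₀ x₀))
      (mixedCourantForm P N u v x₀) := by
  obtain ⟨u1, u2, -, -⟩ := hN.genMatrix_inChart P hu x₀
  obtain ⟨v1, v2, -, -⟩ := hN.genMatrix_inChart P hv x₀
  have h1 := courantBracket_fst (fun y => genMatrix P N y (u y))
    (fun y => genMatrix P N y (v y)) x₀
  have h2 := courantBracket_fst u v x₀
  have h3 := courantBracket_fst (fun y => genMatrix P N y (u y)) v x₀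
  have h4 := courantBracket_fst u (fun y => genMatrix P N y (v y)) x₀
  simp only [u1, u2, v1, v2] at h1 h3 h4
  have hs : ∀ l : E →L[ℝ] ℝ, sharpInChart P x₀ (chartAt E x₀ x₀) l = sharp (P.toFun x₀) l := by
    intro l
    refine (SeparatingDual.eq_iff_forall_dual_eq (R := ℝ)).2 fun m => ?_
    rw [apply_sharpInChart, bivectorInChart_self]
    exact (apply_sharp (P.toFun x₀) l m).symm
  have h5 : (courantTorsion P N u v x₀).1 =
      (courantBracket (fun y => genMatrix P N y (u y)) (fun y => genMatrix P N y (v y)) x₀).1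
      - (courantBracket u v x₀).1
      - (N x₀ ((courantBracket (fun y => genMatrix P N y (u y)) v x₀).1
          + (courantBracket u (fun y => genMatrix P N y (v y)) x₀).1)
        + sharp (P.toFun x₀) (mixedCourantForm (E := E) P N u v x₀)) := rfl
  rw [h5, h1, h2, h3, h4]
  unfold JetVectorTorsionFree
  exact Eq.congr_left (congrArg (HSub.hSub (α := E) (β := E) _)
    (congrArg₂ (HAdd.hAdd (α := E) (β := E)) (hN.apply_eq x₀ _) (hs _).symm))

theorem ConstantInCharts.courantTorsion_snd (hN : ConstantInCharts N J)
    {u v : ∀ x : M, GenTan (E := E) x} (hu : SmoothGenSection u) (hv : SmoothGenSection v)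
    (x₀ : M) :
    (courantTorsion P N u v x₀).2 = 0 ↔
    JetFormTorsionFree J (sharpInChart P x₀ (chartAt E x₀ x₀))
      (fderiv ℝ (sharpInChart P x₀) (chartAt E x₀ x₀))
      (HolPoisson.vectorFieldInChart x₀ (fun x => (u x).1) (chartAt E x₀ x₀))
      (fderiv ℝ (HolPoisson.vectorFieldInChart x₀ fun x => (u x).1) (chartAt E x₀ x₀))
      (HolPoisson.covectorInChart x₀ (fun x => (u x).2) (chartAt E x₀ x₀))
      (fderiv ℝ (HolPoisson.covectorInChart x₀ fun x => (u x).2) (chartAt E x₀ x₀))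
      (HolPoisson.vectorFieldInChart x₀ (fun x => (v x).1) (chartAt E x₀ x₀))
      (fderiv ℝ (HolPoisson.vectorFieldInChart x₀ fun x => (v x).1) (chartAt E x₀ x₀))
      (HolPoisson.covectorInChart x₀ (fun x => (v x).2) (chartAt E x₀ x₀))
      (fderiv ℝ (HolPoisson.covectorInChart x₀ fun x => (v x).2) (chartAt E x₀ x₀))
      (mixedCourantForm P N u v x₀) := by
  obtain ⟨u1, u2, u3, u4⟩ := hN.genMatrix_inChart P hu x₀
  obtain ⟨v1, v2, v3, v4⟩ := hN.genMatrix_inChart P hv x₀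
  rw [show (courantTorsion P N u v x₀).2 = 0 ↔
    ∀ z : E, modelCovector (courantTorsion P N u v x₀).2 z = 0 from DFunLike.ext_iff]
  refine forall_congr' fun z => ?_
  have h1 := courantBracket_snd_apply (hN.smoothGenSection P hu) (hN.smoothGenSection P hv) x₀ z
  have h2 := courantBracket_snd_apply hu hv x₀ z
  rw [u1, u3, funext u2, funext u4, v1, v3, funext v2, funext v4] at h1
  have h3 : modelCovector (courantTorsion P N u v x₀).2 z =
      modelCovector (courantBracket (fun y => genMatrix P N y (u y))
        (fun y => genMatrix P N y (v y)) x₀).2 z - modelCovector (courantBracket u v x₀).2 z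
      - -(mixedCourantForm P N u v x₀ (N x₀ z)) := rfl
  rw [h3, h1, h2, sub_neg_eq_add, hN.apply_eq]

end Torsion

/-- Square and orthogonality follow from `J² = -1`, commutation and skewness of `P`, so
integrability carries the whole content. Necessity is tested on constant germs of one-forms;
sufficiency is the jet computation for arbitrary sections. -/
theorem ConstantInCharts.isGeneralizedComplex_iff [T2Space M] (hN : ConstantInCharts N J)
    (hJ : ∀ v, J (J v) = -v)
    (hcomm : ∀ (x : M) (α : Cotan (E := E) ℝ x),
      N x (sharp (P.toFun x) α) = sharp (P.toFun x) (α.comp (N x))) :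
    IsGeneralizedComplex (genMatrix P N) ↔ ∀ x₀ : M,
      JetHolomorphic J (fderiv ℝ (sharpInChart P x₀) (chartAt E x₀ x₀)) ∧
      JetPoisson (sharpInChart P x₀ (chartAt E x₀ x₀))
        (fderiv ℝ (sharpInChart P x₀) (chartAt E x₀ x₀)) := by
  have hNN : ∀ (x : M) (v : Tan (E := E) x), N x (N x v) = -v := by
    intro x v
    have key : ∀ v : E, N x v = J v := hN.apply_eq x
    exact (congrArg (N x) (key v)).trans ((key _).trans (hJ v))
  constructor
  · intro h x₀
    have key : ∀ a b : E →L[ℝ] ℝ, ∃ u v : ∀ x : M, GenTan (E := E) x,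
        SmoothGenSection u ∧ SmoothGenSection v ∧
        (HolPoisson.vectorFieldInChart x₀ fun x => (u x).1) = (fun _ => 0) ∧
        (HolPoisson.vectorFieldInChart x₀ fun x => (v x).1) = (fun _ => 0) ∧
        (HolPoisson.covectorInChart x₀ fun x => (u x).2) =ᶠ[𝓝 (chartAt E x₀ x₀)] (fun _ => a) ∧
        (HolPoisson.covectorInChart x₀ fun x => (v x).2) =ᶠ[𝓝 (chartAt E x₀ x₀)] (fun _ => b) := by
      intro a b
      obtain ⟨α, hα, ha⟩ := exists_smoothOneForm_eventuallyEq a x₀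
      obtain ⟨β, hβ, hb⟩ := exists_smoothOneForm_eventuallyEq b x₀
      rw [oneFormInChart_eq] at ha hb
      exact ⟨fun x => (0, α x), fun x => (0, β x), ⟨SmoothVectorField.zero, hα⟩,
        ⟨SmoothVectorField.zero, hβ⟩, vectorFieldInChart_zero x₀, vectorFieldInChart_zero x₀,
        ha, hb⟩
    have key2 : ∀ a b ξ, IsMixedCourantForm J (sharpInChart P x₀ (chartAt E x₀ x₀))
        (fderiv ℝ (sharpInChart P x₀) (chartAt E x₀ x₀)) 0 0 a 0 0 0 b 0 ξ →
        JetVectorTorsionFree J (sharpInChart P x₀ (chartAt E x₀ x₀))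
          (fderiv ℝ (sharpInChart P x₀) (chartAt E x₀ x₀)) 0 0 a 0 0 0 b 0 ξ ∧
        JetFormTorsionFree J (sharpInChart P x₀ (chartAt E x₀ x₀))
          (fderiv ℝ (sharpInChart P x₀) (chartAt E x₀ x₀)) 0 0 a 0 0 0 b 0 ξ := by
      intro a b ξ hξ
      obtain ⟨u, v, hu, hv, u1, v1, u2, v2⟩ := key a b
      have hm := hN.isMixedCourantForm (P := P) hu hv x₀
      have h0 : courantTorsion P N u v x₀ = 0 := h.integrable u v hu hv x₀
      have h1 := (hN.courantTorsion_fst hu hv x₀).1 (congrArg Prod.fst h0)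
      have h2 := (hN.courantTorsion_snd hu hv x₀).1 (congrArg Prod.snd h0)
      rw [u1, v1, u2.fderiv_eq, v2.fderiv_eq, u2.self_of_nhds, v2.self_of_nhds,
        fderiv_fun_const, fderiv_fun_const, fderiv_fun_const] at hm h1 h2
      -- The defining identity prescribes `ξ` on every vector, so `ξ` must be the mixed form of the
      -- chosen sections.
      have hξm : ξ = mixedCourantForm P N u v x₀ := by
        ext z
        rw [hξ, hm]
        rfl
      rw [hξm]
      exact ⟨h1, h2⟩
    exact jetHolomorphic_and_jetPoisson (hN.bivectorJet hJ hcomm x₀)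
      (fun a b ξ hξ => (key2 a b ξ hξ).1) (fun a b ξ hξ => (key2 a b ξ hξ).2)
  · intro h
    refine ⟨fun u hu => hN.smoothGenSection P hu, fun x u => ?_, fun x u v => ?_,
      fun u v hu hv x => ?_⟩
    · refine Prod.ext ?_ ?_
      · change N x (N x u.1 + sharp (P.toFun x) u.2)
          + sharp (P.toFun x) (-(u.2.comp (N x))) = -u.1
        rw [map_add, map_neg, hNN, hcomm]
        abel
      · ext z
        change -(-(u.2 (N x (N x z)))) = -(u.2 z)
        rw [hNN, map_neg, neg_neg]
    · have e1 := apply_sharp (P.toFun x) u.2 (v.2.comp (N x))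
      have e2 := apply_sharp (P.toFun x) (u.2.comp (N x)) v.2
      change (-(u.2 (N x (N x v.1 + sharp (P.toFun x) v.2)))
        + -(v.2 (N x (N x u.1 + sharp (P.toFun x) u.2)))) / 2 = (u.2 v.1 + v.2 u.1) / 2
      have hskew : u.2 (sharp (P.toFun x) (v.2.comp (N x))) = -(v.2.comp (N x))
          (sharp (P.toFun x) u.2) := by
        rw [apply_sharp, apply_sharp]
        -- Polarization of the alternating property gives skewness.
        have := P.alternating x (u.2 + v.2.comp (N x))
        simp only [map_add, LinearMap.add_apply, P.alternating] at this
        linear_combination this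
      have e3 : (v.2.comp (N x)) (sharp (P.toFun x) u.2) = v.2 (N x (sharp (P.toFun x) u.2)) := rfl
      simp only [map_add, hNN, map_neg]
      rw [hcomm x v.2, hskew, e3]
      ring
    · obtain ⟨hH, hT⟩ := h x
      have hj := hN.bivectorJet hJ hcomm x
      have hm := hN.isMixedCourantForm (P := P) hu hv x
      exact Prod.ext ((hN.courantTorsion_fst hu hv x).2 (jetVectorTorsionFree hj hH hT hm))
        ((hN.courantTorsion_snd hu hv x).2 (jetFormTorsionFree hj hH hm))

end GeneralizedComplex

/-! ### Compatibility of the brackets of one-forms -/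

section Compatibility

variable {E : Type*} [NormedAddCommGroup E] [NormedSpace ℝ E] [FiniteDimensional ℝ E]
  {M : Type*} [TopologicalSpace M] [ChartedSpace E M] [IsManifold 𝓘(ℝ, E) ∞ M]
  {N : ∀ x : M, Tan (E := E) x →L[ℝ] Tan (E := E) x} {J : E →L[ℝ] E}
  {P : BivectorField E M ℝ}

theorem formBracket_apply
    {Q : ∀ x : M, Cotan (E := E) ℝ x →ₗ[ℝ] Cotan (E := E) ℝ x →ₗ[ℝ] ℝ}
    {α β : ∀ x : M, Cotan (E := E) ℝ x} (hβ : SmoothOneForm β)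
    (hV : SmoothVectorField fun x => sharp (Q x) (α x)) (x₀ : M) (z : E) :
    modelCovector (formBracket Q α β x₀) z = jetFormBracket
      (vectorFieldInChart x₀ (fun x => sharp (Q x) (α x)) (chartAt E x₀ x₀))
      (fderiv ℝ (vectorFieldInChart x₀ fun x => sharp (Q x) (α x)) (chartAt E x₀ x₀))
      (covectorInChart x₀ α (chartAt E x₀ x₀))
      (fderiv ℝ (covectorInChart x₀ α) (chartAt E x₀ x₀))
      (vectorFieldInChart x₀ (fun x => sharp (Q x) (β x)) (chartAt E x₀ x₀))
      (fderiv ℝ (vectorFieldInChart x₀ fun x => sharp (Q x) (β x)) (chartAt E x₀ x₀))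
      (covectorInChart x₀ β (chartAt E x₀ x₀))
      (fderiv ℝ (covectorInChart x₀ β) (chartAt E x₀ x₀)) z := by
  obtain ⟨-, h2⟩ := differential_pairing hβ hV x₀
  have h3 : (fun y => Q y (α y) (β y)) = fun y => β y (sharp (Q y) (α y)) :=
    funext fun y => (apply_sharp (Q y) (α y) (β y)).symm
  have h4 : modelCovector (formBracket Q α β x₀) z =
      modelCovector (lieDerivative (fun y => sharp (Q y) (α y)) β x₀) z
      - modelCovector (lieDerivative (fun y => sharp (Q y) (β y)) α x₀) z
      - modelCovector (differential (fun y => β y (sharp (Q y) (α y))) x₀) z := by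
    rw [← h3]
    rfl
  rw [h4, h2, lieDerivative_apply, lieDerivative_apply, jetFormBracket]

theorem formBracket_apply_bivector {α β : ∀ x : M, Cotan (E := E) ℝ x}
    (hα : SmoothOneForm α) (hβ : SmoothOneForm β) (x₀ : M) (z : E) :
    modelCovector (formBracket P.toFun α β x₀) z = jetFormBracket
      (sharpInChart P x₀ (chartAt E x₀ x₀) (covectorInChart x₀ α (chartAt E x₀ x₀)))
      (fun z => fderiv ℝ (sharpInChart P x₀) (chartAt E x₀ x₀) z
          (covectorInChart x₀ α (chartAt E x₀ x₀))
        + sharpInChart P x₀ (chartAt E x₀ x₀)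
          (fderiv ℝ (covectorInChart x₀ α) (chartAt E x₀ x₀) z))
      (covectorInChart x₀ α (chartAt E x₀ x₀))
      (fderiv ℝ (covectorInChart x₀ α) (chartAt E x₀ x₀))
      (sharpInChart P x₀ (chartAt E x₀ x₀) (covectorInChart x₀ β (chartAt E x₀ x₀)))
      (fun z => fderiv ℝ (sharpInChart P x₀) (chartAt E x₀ x₀) z
          (covectorInChart x₀ β (chartAt E x₀ x₀))
        + sharpInChart P x₀ (chartAt E x₀ x₀)
          (fderiv ℝ (covectorInChart x₀ β) (chartAt E x₀ x₀) z))
      (covectorInChart x₀ β (chartAt E x₀ x₀))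
      (fderiv ℝ (covectorInChart x₀ β) (chartAt E x₀ x₀)) z := by
  rw [formBracket_apply hβ (hα.smoothVectorField_sharp P),
    vectorFieldInChart_sharp P x₀ (mem_chart_target E x₀),
    vectorFieldInChart_sharp P x₀ (mem_chart_target E x₀),
    funext (fderiv_vectorFieldInChart_sharp P hα x₀),
    funext (fderiv_vectorFieldInChart_sharp P hβ x₀)]

theorem ConstantInCharts.compatible_iff_jetCompatible (hN : ConstantInCharts N J)
    {α β : ∀ x : M, Cotan (E := E) ℝ x} (hα : SmoothOneForm α) (hβ : SmoothOneForm β) (x₀ : M) :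
    formBracket (deform P.toFun N) α β x₀
        = formBracket P.toFun (fun y => (α y).comp (N y)) β x₀
          + formBracket P.toFun α (fun y => (β y).comp (N y)) x₀
          - (formBracket P.toFun α β x₀).comp (N x₀) ↔
      JetCompatible J (sharpInChart P x₀ (chartAt E x₀ x₀))
        (fderiv ℝ (sharpInChart P x₀) (chartAt E x₀ x₀))
        (HolPoisson.covectorInChart x₀ α (chartAt E x₀ x₀))
        (fderiv ℝ (HolPoisson.covectorInChart x₀ α) (chartAt E x₀ x₀))
        (HolPoisson.covectorInChart x₀ β (chartAt E x₀ x₀))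
        (fderiv ℝ (HolPoisson.covectorInChart x₀ β) (chartAt E x₀ x₀)) := by
  have hαN := hN.smoothOneForm hα
  have hβN := hN.smoothOneForm hβ
  have hy := mem_chart_target E x₀
  have h1 : ∀ z : E, modelCovector (formBracket (deform P.toFun N) α β x₀) z = _ := fun z =>
    formBracket_apply (Q := deform P.toFun N) (α := α) hβ (hαN.smoothVectorField_sharp P) x₀ z
  -- `P_N^♯ γ` is `P^♯ (N^* γ)` by definition, so the formulas for `P^♯` apply to `N^* γ` and
  -- smoothness of `P_N` needs no separate argument.
  have e1 : ∀ γ : ∀ x : M, Cotan (E := E) ℝ x,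
      HolPoisson.vectorFieldInChart x₀ (fun x => sharp (deform P.toFun N x) (γ x))
      = HolPoisson.vectorFieldInChart x₀ fun x => sharp (P.toFun x) ((γ x).comp (N x)) :=
    fun _ => rfl
  refine Iff.trans (b := ∀ z : E, modelCovector (formBracket (deform P.toFun N) α β x₀) z
    = modelCovector (formBracket P.toFun (fun y => (α y).comp (N y)) β x₀) z
      + modelCovector (formBracket P.toFun α (fun y => (β y).comp (N y)) x₀) z
      - modelCovector (formBracket P.toFun α β x₀) (N x₀ z)) ?_ ?_
  · exact DFunLike.ext_iff
  refine forall_congr' fun z => ?_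
  rw [h1, e1, e1, vectorFieldInChart_sharp P x₀ hy, vectorFieldInChart_sharp P x₀ hy,
    funext (fderiv_vectorFieldInChart_sharp P hαN x₀),
    funext (fderiv_vectorFieldInChart_sharp P hβN x₀), hN.apply_eq,
    formBracket_apply_bivector hαN hβ, formBracket_apply_bivector hα hβN,
    formBracket_apply_bivector hα hβ, hN.covectorInChart x₀ hy, hN.covectorInChart x₀ hy,
    funext (hN.fderiv_covectorInChart hα x₀), funext (hN.fderiv_covectorInChart hβ x₀)]

/-- The jet condition involves only the values of the two forms at the point, and every pair of
values is attained by smooth forms. Compatibility therefore amounts to holomorphy of the jet at each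
point. -/
theorem ConstantInCharts.compatible_iff [T2Space M] (hN : ConstantInCharts N J)
    (hJ : ∀ v, J (J v) = -v)
    (hcomm : ∀ (x : M) (α : Cotan (E := E) ℝ x),
      N x (sharp (P.toFun x) α) = sharp (P.toFun x) (α.comp (N x))) :
    (∀ α β : (∀ x : M, Cotan (E := E) ℝ x), SmoothOneForm α → SmoothOneForm β → ∀ x : M,
      formBracket (deform P.toFun N) α β x
        = formBracket P.toFun (fun y => (α y).comp (N y)) β x
          + formBracket P.toFun α (fun y => (β y).comp (N y)) x
          - (formBracket P.toFun α β x).comp (N x)) ↔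
      ∀ x₀ : M, JetHolomorphic J (fderiv ℝ (sharpInChart P x₀) (chartAt E x₀ x₀)) := by
  constructor
  · intro h x₀ z a
    refine (SeparatingDual.eq_iff_forall_dual_eq (R := ℝ)).2 fun b => ?_
    obtain ⟨α, hα, ha⟩ := exists_smoothOneForm_eventuallyEq a x₀
    obtain ⟨β, hβ, hb⟩ := exists_smoothOneForm_eventuallyEq b x₀
    rw [oneFormInChart_eq] at ha hb
    have h1 := (hN.compatible_iff_jetCompatible hα hβ x₀).1 (h α β hα hβ x₀)
    rw [jetCompatible_iff (hN.bivectorJet hJ hcomm x₀), ha.self_of_nhds, hb.self_of_nhds] at h1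
    exact h1 z
  · intro h α β hα hβ x₀
    rw [hN.compatible_iff_jetCompatible hα hβ x₀, jetCompatible_iff (hN.bivectorJet hJ hcomm x₀)]
    intro z
    rw [h x₀ z]

end Compatibility

/-! ### The Schouten square as a Jacobiator on covectors -/

section Jacobiator

variable {E : Type*} [NormedAddCommGroup E] [NormedSpace ℝ E]
  {𝕜 : Type*} [NormedField 𝕜] [NormedAlgebra ℝ 𝕜]

/-- The differential of `P(a, b)` for constant covectors `a`, `b`, where `DB` is the derivative of
the coefficients of the bivector field `P`. -/
def derivPairing (DB : E →L[ℝ] (E →L[ℝ] 𝕜) →L[ℝ] (E →L[ℝ] 𝕜) →L[ℝ] 𝕜) (a b : E →L[ℝ] 𝕜) :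
    E →L[ℝ] 𝕜 := (DB.flip a).flip b

@[simp] theorem derivPairing_apply (DB : E →L[ℝ] (E →L[ℝ] 𝕜) →L[ℝ] (E →L[ℝ] 𝕜) →L[ℝ] 𝕜)
    (a b : E →L[ℝ] 𝕜) (z : E) : derivPairing DB a b z = DB z a b := rfl

/-- The value on constant covectors of the Jacobiator of a bivector with coefficients `B` whose
derivative is `DB`. -/
def jacobiator (B : (E →L[ℝ] 𝕜) →L[ℝ] (E →L[ℝ] 𝕜) →L[ℝ] 𝕜)
    (DB : E →L[ℝ] (E →L[ℝ] 𝕜) →L[ℝ] (E →L[ℝ] 𝕜) →L[ℝ] 𝕜) (a b c : E →L[ℝ] 𝕜) : 𝕜 :=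
  B (derivPairing DB a b) c + B (derivPairing DB b c) a + B (derivPairing DB c a) b

end Jacobiator

section Schouten

variable {E : Type*} [NormedAddCommGroup E] [NormedSpace ℝ E] [FiniteDimensional ℝ E]
  {M : Type*} [TopologicalSpace M] [ChartedSpace E M]
  {𝕜 : Type*} [NormedField 𝕜] [NormedAlgebra ℝ 𝕜] [FiniteDimensional ℝ 𝕜]

/-- Second-order terms in the Jacobiator cancel by symmetry of second derivatives. -/
theorem bivector_comp_symmetric (P : BivectorField E M 𝕜) (x₀ : M) (y : E)
    (S : E →L[ℝ] E →L[ℝ] 𝕜) (hS : ∀ v w, S v w = S w v) (b c : E →L[ℝ] 𝕜) :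
    bivectorInChart P x₀ y (((bivectorInChart P x₀ y).flip b).comp S) c
      + bivectorInChart P x₀ y ((bivectorInChart P x₀ y c).comp S) b = 0 := by
  let e := Module.finBasis ℝ E
  -- Real coordinate forms with values in `𝕜`; they span the `𝕜`-valued forms over `𝕜`, so
  -- `𝕜`-linearity expands the bivector in coefficients.
  let ε : Fin (Module.finrank ℝ E) → (E →L[ℝ] 𝕜) := fun i =>
    (algebraMapCLM ℝ 𝕜).comp (LinearMap.toContinuousLinearMap (e.coord i))
  have hl : ∀ l : E →L[ℝ] 𝕜, l = ∑ i, l (e i) • ε i := by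
    intro l
    ext v
    conv_lhs => rw [← e.sum_repr v]
    simp only [map_sum, map_smul, _root_.sum_apply, _root_.smul_apply]
    refine Finset.sum_congr rfl fun i _ => ?_
    simp [ε, Algebra.smul_def, mul_comm]
  have hB : ∀ l m : E →L[ℝ] 𝕜, bivectorInChart P x₀ y l m
      = ∑ i, l (e i) * bivectorInChart P x₀ y (ε i) m := by
    intro l m
    conv_lhs => rw [hl l]
    simp only [map_sum, _root_.sum_apply, bivectorInChart_smul_left]
  rw [hB (ContinuousLinearMap.comp _ _) c, hB (ContinuousLinearMap.comp _ _) b]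
  simp only [ContinuousLinearMap.comp_apply, ContinuousLinearMap.flip_apply]
  simp only [bivectorInChart_swap P x₀ y c, hB (S _) b, hB (S _) c]
  simp only [Finset.sum_mul, neg_mul, Finset.sum_neg_distrib]
  -- After exchanging the order of summation, the two double sums differ only by the order of the
  -- arguments of `S`.
  rw [add_neg_eq_zero, Finset.sum_comm]
  refine Finset.sum_congr rfl fun i _ => Finset.sum_congr rfl fun j _ => ?_
  rw [hS]
  ring

variable [IsManifold 𝓘(ℝ, E) ∞ M]

/-- Product rule for `B(df, dg)`: one term differentiates the coefficients, the other two contain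
the Hessians of `f` and `g`. -/
theorem functionBracket_functionBracket (P : BivectorField E M 𝕜) {f g h : M → 𝕜}
    (hf : ContMDiff 𝓘(ℝ, E) 𝓘(ℝ, 𝕜) ∞ f) (hg : ContMDiff 𝓘(ℝ, E) 𝓘(ℝ, 𝕜) ∞ g)
    (hh : ContMDiff 𝓘(ℝ, E) 𝓘(ℝ, 𝕜) ∞ h) (x₀ : M) :
    let y₀ := chartAt E x₀ x₀
    let f' := f ∘ (chartAt E x₀).symm
    let g' := g ∘ (chartAt E x₀).symm
    let h' := h ∘ (chartAt E x₀).symm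
    let B := bivectorInChart P x₀ y₀
    functionBracket P (functionBracket P f g) h x₀
      = B (derivPairing (fderiv ℝ (bivectorInChart P x₀) y₀) (fderiv ℝ f' y₀) (fderiv ℝ g' y₀))
          (fderiv ℝ h' y₀)
        + B ((B.flip (fderiv ℝ g' y₀)).comp (fderiv ℝ (fderiv ℝ f') y₀)) (fderiv ℝ h' y₀)
        + B ((B (fderiv ℝ f' y₀)).comp (fderiv ℝ (fderiv ℝ g') y₀)) (fderiv ℝ h' y₀) := by
  intro y₀ f' g' h' B
  have hfg := ContMDiff.functionBracket P hf hg
  have hy := mem_chart_target E x₀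
  have h1 := functionBracket_eq_bivectorInChart P (hfg.mdifferentiable (by simp))
    (hh.mdifferentiable (by simp)) x₀ hy
  rw [(chartAt E x₀).left_inv (mem_chart_source E x₀)] at h1
  have hev : functionBracket P f g ∘ (chartAt E x₀).symm =ᶠ[𝓝 (chartAt E x₀ x₀)]
      fun y => bivectorInChart P x₀ y (fderiv ℝ f' y) (fderiv ℝ g' y) := by
    filter_upwards [chart_target_mem_nhds x₀] with y hy
    exact functionBracket_eq_bivectorInChart P (hf.mdifferentiable (by simp))
      (hg.mdifferentiable (by simp)) x₀ hy
  have hf' := ((contMDiffAt_iff_comp_chartAt_symm.1 (hf x₀)).fderiv_right (m := ∞)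
    (by simp)).differentiableAt (by simp)
  have hg' := ((contMDiffAt_iff_comp_chartAt_symm.1 (hg x₀)).fderiv_right (m := ∞)
    (by simp)).differentiableAt (by simp)
  have hB := (contDiffAt_bivectorInChart P x₀).differentiableAt (by simp)
  have h2 : fderiv ℝ (fun y => bivectorInChart P x₀ y (fderiv ℝ f' y) (fderiv ℝ g' y)) y₀
      = derivPairing (fderiv ℝ (bivectorInChart P x₀) y₀) (fderiv ℝ f' y₀) (fderiv ℝ g' y₀)
        + (B.flip (fderiv ℝ g' y₀)).comp (fderiv ℝ (fderiv ℝ f') y₀)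
        + (B (fderiv ℝ f' y₀)).comp (fderiv ℝ (fderiv ℝ g') y₀) := by
    rw [fderiv_clm_apply (hB.clm_apply hf') hg', fderiv_clm_apply hB hf']
    ext z
    simp [B]
    ring
  rw [h1, hev.fderiv_eq, h2]
  simp only [map_add, add_apply]
  rfl

theorem schoutenBracket_self_apply (P : BivectorField E M 𝕜) {f g h : M → 𝕜}
    (hf : ContMDiff 𝓘(ℝ, E) 𝓘(ℝ, 𝕜) ∞ f) (hg : ContMDiff 𝓘(ℝ, E) 𝓘(ℝ, 𝕜) ∞ g)
    (hh : ContMDiff 𝓘(ℝ, E) 𝓘(ℝ, 𝕜) ∞ h) (x₀ : M) :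
    schoutenBracket P P f g h x₀ = 2 * jacobiator (bivectorInChart P x₀ (chartAt E x₀ x₀))
      (fderiv ℝ (bivectorInChart P x₀) (chartAt E x₀ x₀))
      (fderiv ℝ (f ∘ (chartAt E x₀).symm) (chartAt E x₀ x₀))
      (fderiv ℝ (g ∘ (chartAt E x₀).symm) (chartAt E x₀ x₀))
      (fderiv ℝ (h ∘ (chartAt E x₀).symm) (chartAt E x₀ x₀)) := by
  have hsymm : ∀ k : M → 𝕜, ContMDiff 𝓘(ℝ, E) 𝓘(ℝ, 𝕜) ∞ k → ∀ v w : E,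
      fderiv ℝ (fderiv ℝ (k ∘ (chartAt E x₀).symm)) (chartAt E x₀ x₀) v w
        = fderiv ℝ (fderiv ℝ (k ∘ (chartAt E x₀).symm)) (chartAt E x₀ x₀) w v := by
    intro k hk v w
    exact ((contMDiffAt_iff_comp_chartAt_symm.1 (hk x₀)).isSymmSndFDerivAt
      (by simpa using ENat.LEInfty.out)) v w
  -- The Hessian of `f` occurs in `{{f,g},h}` and in `{{h,f},g}`, and these two occurrences cancel;
  -- likewise for `g` and `h`.
  have s1 := bivector_comp_symmetric P x₀ (chartAt E x₀ x₀) _ (hsymm f hf)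
    (fderiv ℝ (g ∘ (chartAt E x₀).symm) (chartAt E x₀ x₀))
    (fderiv ℝ (h ∘ (chartAt E x₀).symm) (chartAt E x₀ x₀))
  have s2 := bivector_comp_symmetric P x₀ (chartAt E x₀ x₀) _ (hsymm g hg)
    (fderiv ℝ (h ∘ (chartAt E x₀).symm) (chartAt E x₀ x₀))
    (fderiv ℝ (f ∘ (chartAt E x₀).symm) (chartAt E x₀ x₀))
  have s3 := bivector_comp_symmetric P x₀ (chartAt E x₀ x₀) _ (hsymm h hh)
    (fderiv ℝ (f ∘ (chartAt E x₀).symm) (chartAt E x₀ x₀))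
    (fderiv ℝ (g ∘ (chartAt E x₀).symm) (chartAt E x₀ x₀))
  have t1 := functionBracket_functionBracket P hf hg hh x₀
  have t2 := functionBracket_functionBracket P hg hh hf x₀
  have t3 := functionBracket_functionBracket P hh hf hg x₀
  simp only at t1 t2 t3
  simp only [schoutenBracket, Pi.add_apply, t1, t2, t3, jacobiator]
  -- With both arguments equal to `P`, the Schouten bracket counts each of the three cyclic terms
  -- twice.
  linear_combination 2 * s1 + 2 * s2 + 2 * s3

/-- Only first differentials at the point survive in the bracket, and functions with linear germs
realize every triple of covectors. -/
theorem schoutenSquareZero_iff [T2Space M] (P : BivectorField E M 𝕜) :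
    SchoutenSquareZero P ↔ ∀ (x₀ : M) (a b c : E →L[ℝ] 𝕜),
      jacobiator (bivectorInChart P x₀ (chartAt E x₀ x₀))
        (fderiv ℝ (bivectorInChart P x₀) (chartAt E x₀ x₀)) a b c = 0 := by
  constructor
  · intro hP x₀ a b c
    obtain ⟨f, hf, ha⟩ := exists_contMDiff_eventuallyEq a x₀
    obtain ⟨g, hg, hb⟩ := exists_contMDiff_eventuallyEq b x₀
    obtain ⟨h, hh, hc⟩ := exists_contMDiff_eventuallyEq c x₀
    have h1 := schoutenBracket_self_apply P hf hg hh x₀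
    rw [hP f g h hf hg hh, ha.fderiv_eq, hb.fderiv_eq, hc.fderiv_eq, a.fderiv, b.fderiv,
      c.fderiv] at h1
    -- Needed to cancel the factor 2.
    have : CharZero 𝕜 := charZero_of_injective_algebraMap (algebraMap ℝ 𝕜).injective
    simpa using h1.symm
  · intro hP f g h hf hg hh
    ext x₀
    rw [schoutenBracket_self_apply P hf hg hh, hP, mul_zero]
    rfl

end Schouten

section RealSchouten

variable {E : Type*} [NormedAddCommGroup E] [NormedSpace ℝ E] [FiniteDimensional ℝ E]
  {M : Type*} [TopologicalSpace M] [ChartedSpace E M] [IsManifold 𝓘(ℝ, E) ∞ M]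

theorem apply_fderiv_sharpInChart (P : BivectorField E M ℝ) (x₀ : M) (z : E)
    (l m : E →L[ℝ] ℝ) : m (fderiv ℝ (sharpInChart P x₀) (chartAt E x₀ x₀) z l)
      = fderiv ℝ (bivectorInChart P x₀) (chartAt E x₀ x₀) z l m := by
  have hB := ((contDiffAt_bivectorInChart P x₀).differentiableAt (by simp)).hasFDerivAt
  have h : HasFDerivAt (sharpInChart P x₀)
      ((ContinuousLinearMap.postcomp (E →L[ℝ] ℝ) (doubleDualInv E)).comp
        (fderiv ℝ (bivectorInChart P x₀) (chartAt E x₀ x₀))) (chartAt E x₀ x₀) :=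
    (ContinuousLinearMap.postcomp (E →L[ℝ] ℝ) (doubleDualInv E)).hasFDerivAt.comp _ hB
  rw [h.fderiv]
  exact apply_doubleDualInv _ _

/-- By skewness, contracting the differential of `P(a,b)` with `c` gives minus its derivative along
`P^♯ c`. The Jacobiator is thus minus the cyclic sum in `JetPoisson`. -/
theorem isPoissonTensor_iff [T2Space M] (P : BivectorField E M ℝ) :
    IsPoissonTensor P ↔ ∀ x₀ : M, JetPoisson (sharpInChart P x₀ (chartAt E x₀ x₀))
      (fderiv ℝ (sharpInChart P x₀) (chartAt E x₀ x₀)) := by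
  unfold IsPoissonTensor
  rw [schoutenSquareZero_iff]
  refine forall_congr' fun x₀ => ?_
  have key : ∀ a b c, bivectorInChart P x₀ (chartAt E x₀ x₀)
      (derivPairing (fderiv ℝ (bivectorInChart P x₀) (chartAt E x₀ x₀)) a b) c
      = -b (fderiv ℝ (sharpInChart P x₀) (chartAt E x₀ x₀)
        (sharpInChart P x₀ (chartAt E x₀ x₀) c) a) := by
    intro a b c
    rw [bivectorInChart_swap, ← apply_sharpInChart, derivPairing_apply,
      apply_fderiv_sharpInChart]
  unfold JetPoisson jacobiator
  simp only [key]
  constructor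
  · intro h a b c
    linear_combination -h a b c
  · intro h a b c
    linear_combination -h a b c

end RealSchouten

/-! ### Complex bivectors: type (2,0), holomorphic jets, imaginary parts -/

section ComplexForms

variable {E : Type*} [NormedAddCommGroup E] [NormedSpace ℂ E]

variable (E) in
/-- Multiplication by `i` on the model space. -/
def mulI : E →L[ℝ] E := (Complex.I • ContinuousLinearMap.id ℂ E).restrictScalars ℝ

@[simp] theorem mulI_apply (v : E) : mulI E v = Complex.I • v := rfl

theorem mulI_mulI (v : E) : mulI E (mulI E v) = -v := by
  simp [smul_smul]

/-- The complex-valued extension of a real linear form. -/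
def complexify (a : E →L[ℝ] ℝ) : E →L[ℝ] ℂ := Complex.ofRealCLM.comp a

theorem complexify_comp (a : E →L[ℝ] ℝ) (A : E →L[ℝ] E) :
    (complexify a).comp A = complexify (a.comp A) := rfl

theorem eq_complexify_add (l : E →L[ℝ] ℂ) :
    l = complexify (Complex.reCLM.comp l) + Complex.I • complexify (Complex.imCLM.comp l) := by
  ext v
  simp [complexify, mul_comm Complex.I, Complex.re_add_im]

/-- An alternating form, complex bilinear on the complexified dual space. -/
structure IsComplexAlternating (B : (E →L[ℝ] ℂ) →L[ℝ] (E →L[ℝ] ℂ) →L[ℝ] ℂ) : Prop where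
  smul_left : ∀ (c : ℂ) l m, B (c • l) m = c * B l m
  swap : ∀ l m, B l m = -B m l

/-- A form on the complexified dual space which belongs to `∧² E^{1,0}`. -/
def IsTypeTwoZeroForm (B : (E →L[ℝ] ℂ) →L[ℝ] (E →L[ℝ] ℂ) →L[ℝ] ℂ) : Prop :=
  ∀ l m, B (l.comp (mulI E)) m = Complex.I * B l m

variable {B B' : (E →L[ℝ] ℂ) →L[ℝ] (E →L[ℝ] ℂ) →L[ℝ] ℂ}

theorem IsComplexAlternating.smul_right (hB : IsComplexAlternating B) (c : ℂ) (l m : E →L[ℝ] ℂ) :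
    B l (c • m) = c * B l m := by
  rw [hB.swap, hB.smul_left, hB.swap m]
  ring

theorem IsComplexAlternating.apply_eq (hB : IsComplexAlternating B) (l m : E →L[ℝ] ℂ) :
    B l m = B (complexify (Complex.reCLM.comp l)) m
      + Complex.I * B (complexify (Complex.imCLM.comp l)) m := by
  conv_lhs => rw [eq_complexify_add l]
  rw [map_add, add_apply, hB.smul_left]

theorem IsComplexAlternating.apply_eq_right (hB : IsComplexAlternating B) (l m : E →L[ℝ] ℂ) :
    B l m = B l (complexify (Complex.reCLM.comp m))
      + Complex.I * B l (complexify (Complex.imCLM.comp m)) := by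
  conv_lhs => rw [eq_complexify_add m]
  rw [map_add, hB.smul_right]

theorem IsComplexAlternating.eq_smul (hB : IsComplexAlternating B) (hB' : IsComplexAlternating B')
    {c : ℂ} (h : ∀ a b, B (complexify a) (complexify b) = c * B' (complexify a) (complexify b))
    (l m : E →L[ℝ] ℂ) : B l m = c * B' l m := by
  have h1 : ∀ a m, B (complexify a) m = c * B' (complexify a) m := by
    intro a m
    rw [hB.apply_eq_right, h, h, hB'.apply_eq_right _ m]
    ring
  rw [hB.apply_eq, h1, h1, hB'.apply_eq l]
  ring

theorem IsComplexAlternating.comp_right (hB : IsComplexAlternating B) (h : IsTypeTwoZeroForm B)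
    (l m : E →L[ℝ] ℂ) : B l (m.comp (mulI E)) = Complex.I * B l m := by
  rw [hB.swap, h, hB.swap m]
  ring

/-- The right-hand side is the imaginary part of `B(J^*a, b) = i B(a, b)` for real covectors. The
real part follows by replacing `a` with `J^*a`, and complex bilinearity extends the identity to all
forms. -/
theorem IsComplexAlternating.isTypeTwoZeroForm_iff (hB : IsComplexAlternating B) :
    IsTypeTwoZeroForm B ↔ ∀ a b : E →L[ℝ] ℝ,
      (B (complexify a) (complexify b)).re
        = (B (complexify (a.comp (mulI E))) (complexify b)).im := by
  constructor
  · intro h a b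
    rw [← complexify_comp, h]
    simp
  · intro h
    have hJJ : ∀ a : E →L[ℝ] ℝ, (a.comp (mulI E)).comp (mulI E) = -a := by
      intro a
      ext v
      simp [smul_smul]
    have h1 : ∀ a b : E →L[ℝ] ℝ, B (complexify (a.comp (mulI E))) (complexify b)
        = Complex.I * B (complexify a) (complexify b) := by
      intro a b
      have h2 := h (a.comp (mulI E)) b
      have h3 : complexify (-a) = -complexify a := by ext; simp [complexify]
      rw [hJJ, h3, map_neg, neg_apply, Complex.neg_im] at h2
      apply Complex.ext
      · simp [h2]
      · simp [h]
    have h2 : ∀ a m, B (complexify (a.comp (mulI E))) m = Complex.I * B (complexify a) m := by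
      intro a m
      rw [hB.apply_eq_right, h1, h1, hB.apply_eq_right _ m]
      ring
    intro l m
    rw [hB.apply_eq, hB.apply_eq l]
    have h3 : Complex.reCLM.comp (l.comp (mulI E)) = (Complex.reCLM.comp l).comp (mulI E) := rfl
    have h4 : Complex.imCLM.comp (l.comp (mulI E)) = (Complex.imCLM.comp l).comp (mulI E) := rfl
    rw [h3, h4, h2, h2]
    ring

/-- Forms of type (0,1) are exactly those of the shape `l ∘ J - i l`, and vanishing on these is the
identity `B(l ∘ J, m) = i B(l, m)`. -/
theorem IsComplexAlternating.isTypeTwoZeroForm_iff_forall_eq_zero (hB : IsComplexAlternating B) :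
    IsTypeTwoZeroForm B ↔ ∀ l m : E →L[ℝ] ℂ,
      (∀ v : E, l (Complex.I • v) = -Complex.I * l v) → B l m = 0 := by
  constructor
  · intro h l m hl
    have h1 : l.comp (mulI E) = (-Complex.I) • l := by
      ext v
      simpa using hl v
    have h2 := h l m
    rw [h1, hB.smul_left] at h2
    have h3 : (2 * Complex.I) * B l m = 0 := by linear_combination -h2
    simpa using h3
  · intro h l m
    have h1 := h (l.comp (mulI E) - Complex.I • l) m (fun v => by
      simp only [ContinuousLinearMap.comp_apply, sub_apply, smul_apply, mulI_apply, smul_smul,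
        Complex.I_mul_I, neg_smul, one_smul, map_neg, smul_eq_mul]
      linear_combination -l v * Complex.I_mul_I)
    rw [map_sub, sub_apply, hB.smul_left] at h1
    linear_combination h1

/-- A form in `∧² E^{1,0}` is determined by its values on complex linear forms. -/
theorem IsComplexAlternating.apply_eq_complexLinear (hB : IsComplexAlternating B)
    (h : IsTypeTwoZeroForm B) (l m : E →L[ℝ] ℂ) :
    B l m = 1 / 4 * B (l - Complex.I • l.comp (mulI E)) (m - Complex.I • m.comp (mulI E)) := by
  -- Inside `B` of type (2,0), passing to `l - i l ∘ J` doubles the value because `-i · i = 1`;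
  -- doing so in both slots accounts for the factor 1/4.
  have h1 : ∀ l m, B (l - Complex.I • l.comp (mulI E)) m = 2 * B l m := by
    intro l m
    rw [map_sub, sub_apply, hB.smul_left, h]
    linear_combination -B l m * Complex.I_mul_I
  rw [h1, hB.swap l (_ - _), h1, hB.swap m]
  ring

theorem exists_restrictScalars_eq_of_map_I_smul {F : Type*} [NormedAddCommGroup F]
    [NormedSpace ℂ F] (f : E →L[ℝ] F) (hf : ∀ v, f (Complex.I • v) = Complex.I • f v) :
    ∃ g : E →L[ℂ] F, g.restrictScalars ℝ = f := by
  refine ⟨⟨⟨⟨f, f.map_add⟩, fun c v => ?_⟩, f.cont⟩, rfl⟩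
  have h1 : f ((c.re : ℂ) • v + (c.im : ℂ) • Complex.I • v)
      = (c.re : ℂ) • f v + (c.im : ℂ) • Complex.I • f v := by
    rw [map_add, Complex.coe_smul, Complex.coe_smul, Complex.coe_smul, Complex.coe_smul, map_smul,
      map_smul, hf]
  rw [← mul_smul, ← mul_smul, ← add_smul, ← add_smul, Complex.re_add_im] at h1
  exact h1

/-- The form `l - i l ∘ J` is twice the (1,0) part of `l`. -/
theorem exists_restrictScalars_eq (l : E →L[ℝ] ℂ) :
    ∃ l' : E →L[ℂ] ℂ, l'.restrictScalars ℝ = l - Complex.I • l.comp (mulI E) := by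
  refine exists_restrictScalars_eq_of_map_I_smul _ fun v => ?_
  simp only [ContinuousLinearMap.comp_apply, sub_apply, smul_apply, mulI_apply, smul_smul,
    Complex.I_mul_I, neg_smul, one_smul, map_neg, smul_eq_mul]
  linear_combination l (Complex.I • v) * Complex.I_mul_I

/-- The values `B` and the derivative `DB` at a point of a holomorphic bivector field. -/
structure HolomorphicJet (B : (E →L[ℝ] ℂ) →L[ℝ] (E →L[ℝ] ℂ) →L[ℝ] ℂ)
    (DB : E →L[ℝ] (E →L[ℝ] ℂ) →L[ℝ] (E →L[ℝ] ℂ) →L[ℝ] ℂ) : Prop where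
  alternating : IsComplexAlternating B
  alternating' : ∀ z, IsComplexAlternating (DB z)
  type : IsTypeTwoZeroForm B
  type' : ∀ z, IsTypeTwoZeroForm (DB z)
  holomorphic : ∀ z l m, DB (mulI E z) l m = Complex.I * DB z l m

variable {DB : E →L[ℝ] (E →L[ℝ] ℂ) →L[ℝ] (E →L[ℝ] ℂ) →L[ℝ] ℂ}

theorem jacobiator_rotate (B : (E →L[ℝ] ℂ) →L[ℝ] (E →L[ℝ] ℂ) →L[ℝ] ℂ)
    (DB : E →L[ℝ] (E →L[ℝ] ℂ) →L[ℝ] (E →L[ℝ] ℂ) →L[ℝ] ℂ) (a b c : E →L[ℝ] ℂ) :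
    jacobiator B DB a b c = jacobiator B DB b c a := by
  unfold jacobiator
  ring

/-- Both the bivector and its derivative are complex bilinear in the covectors, hence the Jacobiator
is complex linear in `a`. With cyclic symmetry this reduces its vanishing to real covectors. -/
theorem HolomorphicJet.jacobiator_eq (h : HolomorphicJet B DB) (a b c : E →L[ℝ] ℂ) :
    jacobiator B DB a b c = jacobiator B DB (complexify (Complex.reCLM.comp a)) b c
      + Complex.I * jacobiator B DB (complexify (Complex.imCLM.comp a)) b c := by
  have h1 : ∀ b, derivPairing DB a b = derivPairing DB (complexify (Complex.reCLM.comp a)) b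
      + Complex.I • derivPairing DB (complexify (Complex.imCLM.comp a)) b := by
    intro b
    ext z
    simpa using (h.alternating' z).apply_eq a b
  have h2 : ∀ c, derivPairing DB c a = derivPairing DB c (complexify (Complex.reCLM.comp a))
      + Complex.I • derivPairing DB c (complexify (Complex.imCLM.comp a)) := by
    intro c
    ext z
    have := (h.alternating' z).apply_eq a c
    simp only [derivPairing_apply, add_apply, smul_apply, smul_eq_mul]
    rw [(h.alternating' z).swap c, this, (h.alternating' z).swap c, (h.alternating' z).swap c]
    ring
  have h3 : ∀ l, B l a = B l (complexify (Complex.reCLM.comp a))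
      + Complex.I * B l (complexify (Complex.imCLM.comp a)) := by
    intro l
    rw [h.alternating.swap, h.alternating.apply_eq, h.alternating.swap l, h.alternating.swap l]
    ring
  unfold jacobiator
  rw [h1 b, h2 c, h3, map_add, map_add, add_apply, add_apply, h.alternating.smul_left,
    h.alternating.smul_left]
  ring

theorem HolomorphicJet.jacobiator_eq_zero_iff (h : HolomorphicJet B DB) :
    (∀ a b c, jacobiator B DB a b c = 0) ↔
      ∀ a b c, jacobiator B DB (complexify a) (complexify b) (complexify c) = 0 := by
  refine ⟨fun H a b c => H _ _ _, fun H a b c => ?_⟩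
  have h1 : ∀ a b c, jacobiator B DB a (complexify b) (complexify c) = 0 := by
    intro a b c
    rw [h.jacobiator_eq, H, H, mul_zero, add_zero]
  have h2 : ∀ a b c, jacobiator B DB a b (complexify c) = 0 := by
    intro a b c
    rw [jacobiator_rotate, h.jacobiator_eq, jacobiator_rotate, jacobiator_rotate, h1,
      jacobiator_rotate, jacobiator_rotate, h1, mul_zero, add_zero]
  rw [jacobiator_rotate, jacobiator_rotate, h.jacobiator_eq, jacobiator_rotate, h2,
    jacobiator_rotate, h2, mul_zero, add_zero]

/-- Holomorphy gives `d(π(a,b)) = (J^* + i) d(π_I(a,b))`. Inside a form of type (2,0), `J^*` acts as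
`i`, so this factor becomes `2i`. Since `π(λ,c) = π_I(J^*λ,c) + i π_I(λ,c)`, each cyclic term equals
`-2 π_I(λ,c) + 2i π_I(J^*λ,c)` with `λ = d(π_I(a,b))`. Finally `J^*` is moved onto the covector `a`
in all three terms. -/
theorem HolomorphicJet.jacobiator_complexify (h : HolomorphicJet B DB)
    {A : (E →L[ℝ] ℝ) →L[ℝ] (E →L[ℝ] ℝ) →L[ℝ] ℝ}
    {DA : E →L[ℝ] (E →L[ℝ] ℝ) →L[ℝ] (E →L[ℝ] ℝ) →L[ℝ] ℝ}
    (hA : ∀ a b, A a b = (B (complexify a) (complexify b)).im)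
    (hDA : ∀ z a b, DA z a b = (DB z (complexify a) (complexify b)).im) (a b c : E →L[ℝ] ℝ) :
    jacobiator B DB (complexify a) (complexify b) (complexify c)
      = -2 * jacobiator A DA a b c + 2 * Complex.I * jacobiator A DA (a.comp (mulI E)) b c := by
  have key : ∀ a b c : E →L[ℝ] ℝ,
      B (derivPairing DB (complexify a) (complexify b)) (complexify c)
        = -2 * A (derivPairing DA a b) c
          + 2 * Complex.I * A ((derivPairing DA a b).comp (mulI E)) c := by
    intro a b c
    have h1 : Complex.reCLM.comp (derivPairing DB (complexify a) (complexify b))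
        = (derivPairing DA a b).comp (mulI E) := by
      ext z
      rw [ContinuousLinearMap.comp_apply, ContinuousLinearMap.comp_apply, derivPairing_apply,
        derivPairing_apply, hDA, h.holomorphic]
      simp
    have h2 : Complex.imCLM.comp (derivPairing DB (complexify a) (complexify b))
        = derivPairing DA a b := by
      ext z
      rw [derivPairing_apply, hDA]
      rfl
    rw [h.alternating.apply_eq, h1, h2, hA, hA, ← complexify_comp, h.type]
    apply Complex.ext
    · simp
      ring
    · simp
      ring
  have e1 : derivPairing DA (a.comp (mulI E)) b = (derivPairing DA a b).comp (mulI E) := by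
    ext z
    rw [ContinuousLinearMap.comp_apply, derivPairing_apply, derivPairing_apply, hDA, hDA,
      h.holomorphic, ← complexify_comp, h.type']
  have e2 : derivPairing DA c (a.comp (mulI E)) = (derivPairing DA c a).comp (mulI E) := by
    ext z
    rw [ContinuousLinearMap.comp_apply, derivPairing_apply, derivPairing_apply, hDA, hDA,
      h.holomorphic, ← complexify_comp, (h.alternating' z).comp_right (h.type' z)]
  have e3 : A (derivPairing DA b c) (a.comp (mulI E))
      = A ((derivPairing DA b c).comp (mulI E)) a := by
    rw [hA, hA, ← complexify_comp, ← complexify_comp, h.type, h.alternating.comp_right h.type]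
  unfold jacobiator
  rw [key, key, key, e1, e2, e3]
  push_cast
  ring

theorem HolomorphicJet.jacobiator_eq_zero_iff_im (h : HolomorphicJet B DB)
    {A : (E →L[ℝ] ℝ) →L[ℝ] (E →L[ℝ] ℝ) →L[ℝ] ℝ}
    {DA : E →L[ℝ] (E →L[ℝ] ℝ) →L[ℝ] (E →L[ℝ] ℝ) →L[ℝ] ℝ}
    (hA : ∀ a b, A a b = (B (complexify a) (complexify b)).im)
    (hDA : ∀ z a b, DA z a b = (DB z (complexify a) (complexify b)).im) :
    (∀ a b c, jacobiator B DB a b c = 0) ↔ ∀ a b c, jacobiator A DA a b c = 0 := by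
  rw [h.jacobiator_eq_zero_iff]
  constructor
  · intro H a b c
    -- The real part is -2 times the Jacobiator of the imaginary part.
    have h1 := congrArg Complex.re (h.jacobiator_complexify hA hDA a b c)
    rw [H] at h1
    simpa using h1
  · intro H a b c
    rw [h.jacobiator_complexify hA hDA, H, H]
    simp

end ComplexForms

/-! ### Holomorphic charts and the almost complex structure -/

section ComplexCharts

variable {E : Type*} [NormedAddCommGroup E] [NormedSpace ℂ E]
  {M : Type*} [TopologicalSpace M] [ChartedSpace E M]

theorem differentiableAt_complex_iff {F : Type*} [NormedAddCommGroup F] [NormedSpace ℂ F]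
    {f : E → F} {y : E} : DifferentiableAt ℂ f y ↔ DifferentiableAt ℝ f y ∧
      ∀ z : E, fderiv ℝ f y (Complex.I • z) = Complex.I • fderiv ℝ f y z := by
  constructor
  · intro h
    refine ⟨h.restrictScalars ℝ, fun z => ?_⟩
    rw [h.fderiv_restrictScalars ℝ]
    exact (fderiv ℂ f y).map_smul _ z
  · rintro ⟨h, hI⟩
    exact (differentiableAt_iff_restrictScalars ℝ h).2
      (exists_restrictScalars_eq_of_map_I_smul _ hI)

theorem mdifferentiableAt_iff_comp_chartAt_symm {f : M → ℂ} {x₀ : M} :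
    MDifferentiableAt 𝓘(ℂ, E) 𝓘(ℂ, ℂ) f x₀
      ↔ DifferentiableAt ℂ (f ∘ (chartAt E x₀).symm) (chartAt E x₀ x₀) := by
  rw [mdifferentiableAt_iff]
  have h1 : (chartAt E x₀).symm (chartAt E x₀ x₀) = x₀ :=
    (chartAt E x₀).left_inv (mem_chart_source E x₀)
  simp only [mfld_simps, Set.range_id, differentiableWithinAt_univ]
  refine ⟨fun h => h.2, fun h => ⟨?_, h⟩⟩
  have h2 := ((chartAt E x₀).symm.continuousAt_iff_continuousAt_comp_right (f := f)
    (x := x₀) (by simp)).2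
  exact h2 (by simpa using h.continuousAt)

variable [IsManifold 𝓘(ℂ, E) ω M]

theorem contDiffAt_comp_chartAt_symm {e : OpenPartialHomeomorph M E} (he : e ∈ atlas E M)
    (x₀ : M) {y : E} (hy : y ∈ (chartAt E x₀).target) (hy' : (chartAt E x₀).symm y ∈ e.source) :
    ContDiffAt ℂ ω (e ∘ (chartAt E x₀).symm) y := by
  have h := (contDiffGroupoid ω 𝓘(ℂ, E)).compatible (chart_mem_atlas E x₀) he
  have h3 := (mem_groupoid_of_pregroupoid.mp h).1
  have h4 : ContDiffOn ℂ ω ((chartAt E x₀).symm ≫ₕ e) ((chartAt E x₀).symm ≫ₕ e).source := by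
    simpa [contDiffPregroupoid] using h3
  exact h4.contDiffAt (((chartAt E x₀).symm ≫ₕ e).open_source.mem_nhds (by simp [hy, hy']))

/-- In terms of the identification of the tangent space at `x`, the differential of any chart is the
derivative of a transition map, which is complex linear. -/
theorem chartDifferential_eq_fderiv {e : OpenPartialHomeomorph M E} (he : e ∈ atlas E M)
    {x : M} (hx : x ∈ e.source) :
    chartDifferential e x
      = (fderiv ℂ (e ∘ (chartAt E x).symm) (chartAt E x x)).restrictScalars ℝ := by
  have : IsManifold 𝓘(ℝ, E) 1 M := IsManifold.of_le (n := ∞) (by simp)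
  have h1 : MDifferentiableAt 𝓘(ℝ, E) 𝓘(ℝ, E) e x :=
    mdifferentiableAt_atlas he hx
  have h2 := contDiffAt_comp_chartAt_symm he x (mem_chart_target E x)
    (by rwa [(chartAt E x).left_inv (mem_chart_source E x)])
  rw [← (h2.differentiableAt (by simp)).fderiv_restrictScalars ℝ, chartDifferential, h1.mfderiv]
  simp [writtenInExtChartAt, fderivWithin_univ]
  rfl

/-- Complex linearity of the chart differentials is precisely what makes `J` multiplication by `i`
throughout each chart. -/
theorem constantInCharts_almostComplex : ConstantInCharts (almostComplex E M) (mulI E) := by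
  intro x₀ y hy v
  have h := chartDifferential_eq_fderiv (chart_mem_atlas E x₀) ((chartAt E x₀).map_target hy)
  have h1 : coframe x₀ y = _ := h
  rw [h1]
  exact (fderiv ℂ _ _).map_smul Complex.I v

theorem chartDifferential_chartAt_symm {e : OpenPartialHomeomorph M E} (he : e ∈ atlas E M)
    (x₀ : M) {y : E} (hy : y ∈ (chartAt E x₀).target) (hy' : (chartAt E x₀).symm y ∈ e.source) :
    chartDifferential e ((chartAt E x₀).symm y)
      = ((fderiv ℂ (e ∘ (chartAt E x₀).symm) y).restrictScalars ℝ).comp (coframe x₀ y) := by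
  have : IsManifold 𝓘(ℝ, E) 1 M := IsManifold.of_le (n := ∞) (by simp)
  have h1 : MDifferentiableAt 𝓘(ℝ, E) 𝓘(ℝ, E) e ((chartAt E x₀).symm y) :=
    mdifferentiableAt_atlas he hy'
  have h2 : MDifferentiableAt 𝓘(ℝ, E) 𝓘(ℝ, E) (chartAt E x₀).symm y :=
    mdifferentiableAt_atlas_symm (chart_mem_atlas E x₀) hy
  have h3 := contDiffAt_comp_chartAt_symm he x₀ hy hy'
  have h4 : (fderiv ℂ (e ∘ (chartAt E x₀).symm) y).restrictScalars ℝ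
      = ContinuousLinearMap.comp (chartDifferential e ((chartAt E x₀).symm y)) (frame x₀ y) := by
    rw [← (h3.differentiableAt (by simp)).fderiv_restrictScalars ℝ, ← mfderiv_eq_fderiv]
    exact mfderiv_comp y h1 h2
  rw [h4]
  ext v
  exact (congrArg (chartDifferential e ((chartAt E x₀).symm y))
    (DFunLike.congr_fun (frame_comp_coframe x₀ hy) v)).symm

end ComplexCharts

/-! ### Holomorphic and Poisson conditions in terms of the imaginary part -/

section HolomorphicBivectors

variable {E : Type*} [NormedAddCommGroup E] [NormedSpace ℂ E] [FiniteDimensional ℂ E]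
  {M : Type*} [TopologicalSpace M] [ChartedSpace E M]

theorem isComplexAlternating_bivectorInChart (π : BivectorField E M ℂ) (x₀ : M) (y : E) :
    IsComplexAlternating (bivectorInChart π x₀ y) :=
  ⟨bivectorInChart_smul_left π x₀ y, bivectorInChart_swap π x₀ y⟩

theorem bivectorInChart_im (π : BivectorField E M ℂ) (x₀ : M) (y : E) (a b : E →L[ℝ] ℝ) :
    bivectorInChart π.im x₀ y a b
      = (bivectorInChart π x₀ y (complexify a) (complexify b)).im := rfl

variable [IsManifold 𝓘(ℂ, E) ω M]

theorem hasFDerivAt_bivectorInChart (π : BivectorField E M ℂ) (x₀ : M) (l m : E →L[ℝ] ℂ) :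
    HasFDerivAt (fun y => bivectorInChart π x₀ y l m)
      (derivPairing (fderiv ℝ (bivectorInChart π x₀) (chartAt E x₀ x₀)) l m)
      (chartAt E x₀ x₀) := by
  have h := ((contDiffAt_bivectorInChart π x₀).differentiableAt (by simp)).hasFDerivAt
  have h1 := (h.clm_apply (hasFDerivAt_const l _)).clm_apply (hasFDerivAt_const m _)
  refine h1.congr_fderiv ?_
  ext z
  simp

theorem fderiv_bivectorInChart_im (π : BivectorField E M ℂ) (x₀ : M) (z : E)
    (a b : E →L[ℝ] ℝ) : fderiv ℝ (bivectorInChart π.im x₀) (chartAt E x₀ x₀) z a b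
      = (fderiv ℝ (bivectorInChart π x₀) (chartAt E x₀ x₀) z (complexify a) (complexify b)).im := by
  have h := ((contDiffAt_bivectorInChart π.im x₀).differentiableAt (by simp)).hasFDerivAt
  have h1 := (h.clm_apply (hasFDerivAt_const a _)).clm_apply (hasFDerivAt_const b _)
  have h2 := Complex.imCLM.hasFDerivAt.comp _
    (hasFDerivAt_bivectorInChart π x₀ (complexify a) (complexify b))
  have h3 := DFunLike.congr_fun (h1.unique h2) z
  simpa using h3

theorem isComplexAlternating_fderiv_bivectorInChart (π : BivectorField E M ℂ) (x₀ : M) (z : E) :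
    IsComplexAlternating (fderiv ℝ (bivectorInChart π x₀) (chartAt E x₀ x₀) z) := by
  constructor
  · intro c l m
    have h1 := hasFDerivAt_bivectorInChart π x₀ (c • l) m
    simp only [bivectorInChart_smul_left] at h1
    exact DFunLike.congr_fun
      (h1.unique ((hasFDerivAt_bivectorInChart π x₀ l m).const_mul c)) z
  · intro l m
    have h1 := hasFDerivAt_bivectorInChart π x₀ l m
    simp only [bivectorInChart_swap π x₀ _ l m] at h1
    exact DFunLike.congr_fun
      (h1.unique (hasFDerivAt_bivectorInChart π x₀ m l).neg) z

theorem isTypeTwoZero_iff (π : BivectorField E M ℂ) :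
    IsTypeTwoZero π ↔ ∀ x₀ : M, IsTypeTwoZeroForm (bivectorInChart π x₀ (chartAt E x₀ x₀)) := by
  refine forall_congr' fun x₀ => ?_
  rw [(isComplexAlternating_bivectorInChart π x₀ _).isTypeTwoZeroForm_iff_forall_eq_zero,
    bivectorInChart_self]
  rfl

theorem isTypeTwoZero_iff_sharp (π : BivectorField E M ℂ) :
    IsTypeTwoZero π ↔ ∀ (x : M) (α : Cotan (E := E) ℝ x),
      sharp (π.re.toFun x) α = sharp (π.im.toFun x) (α.comp (almostComplex E M x)) := by
  rw [isTypeTwoZero_iff]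
  refine forall_congr' fun x₀ => ?_
  rw [(isComplexAlternating_bivectorInChart π x₀ _).isTypeTwoZeroForm_iff]
  refine forall_congr' fun a => ?_
  refine Iff.trans ?_ (SeparatingDual.eq_iff_forall_dual_eq (R := ℝ) (V := E)).symm
  refine forall_congr' fun b => ?_
  rw [bivectorInChart_self]
  exact (Eq.congr (apply_sharp (E := E) (π.re.toFun x₀) a b)
    (apply_sharp (E := E) (π.im.toFun x₀) (a.comp (mulI E)) b)).symm

/-- For type (2,0), composing either argument with `J` multiplies `π` by `i`, so `J` may be moved
from one argument to the other; the imaginary part of this identity is the claim. -/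
theorem IsTypeTwoZero.almostComplex_sharp {π : BivectorField E M ℂ} (h : IsTypeTwoZero π) (x : M)
    (α : Cotan (E := E) ℝ x) : almostComplex E M x (sharp (π.im.toFun x) α)
      = sharp (π.im.toFun x) (α.comp (almostComplex E M x)) := by
  have hx := (isTypeTwoZero_iff π).1 h x
  have hA := isComplexAlternating_bivectorInChart π x (chartAt E x x)
  refine (SeparatingDual.eq_iff_forall_dual_eq (R := ℝ) (V := E)).2 fun b => ?_
  let a : E →L[ℝ] ℝ := α
  refine (apply_sharp (E := E) (π.im.toFun x) a (b.comp (mulI E))).trans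
    (Eq.trans ?_ (apply_sharp (E := E) (π.im.toFun x) (a.comp (mulI E)) b).symm)
  have h1 := congrArg Complex.im (hA.comp_right hx (complexify a) (complexify b))
  rw [← hx] at h1
  rw [bivectorInChart_self] at h1
  exact h1

theorem IsTypeTwoZero.bivectorInChart {π : BivectorField E M ℂ} (h : IsTypeTwoZero π) (x₀ : M)
    {y : E} (hy : y ∈ (chartAt E x₀).target) : IsTypeTwoZeroForm (bivectorInChart π x₀ y) := by
  intro l m
  have h1 := (isTypeTwoZero_iff π).1 h ((chartAt E x₀).symm y) (l.comp (coframe x₀ y))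
    (m.comp (coframe x₀ y))
  have h2 : (l.comp (mulI E)).comp (coframe x₀ y) = (l.comp (coframe x₀ y)).comp (mulI E) := by
    ext v
    have h3 := constantInCharts_almostComplex x₀ y hy v
    exact congrArg l h3.symm
  rw [bivectorInChart_self] at h1
  rw [bivectorInChart_apply, h2]
  exact h1

theorem IsTypeTwoZero.fderiv_bivectorInChart {π : BivectorField E M ℂ} (h : IsTypeTwoZero π)
    (x₀ : M) (z : E) :
    IsTypeTwoZeroForm (fderiv ℝ (HolPoisson.bivectorInChart π x₀) (chartAt E x₀ x₀) z) := by
  intro l m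
  have h1 := hasFDerivAt_bivectorInChart π x₀ (l.comp (mulI E)) m
  have h2 : (fun y => HolPoisson.bivectorInChart π x₀ y (l.comp (mulI E)) m)
      =ᶠ[𝓝 (chartAt E x₀ x₀)] fun y => Complex.I * HolPoisson.bivectorInChart π x₀ y l m := by
    filter_upwards [chart_target_mem_nhds x₀] with y hy
    exact h.bivectorInChart x₀ hy l m
  exact DFunLike.congr_fun ((h1.congr_of_eventuallyEq h2.symm).unique
    ((hasFDerivAt_bivectorInChart π x₀ l m).const_mul Complex.I)) z

/-- The definition concerns complex linear forms in every chart, while the jet equation concerns all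
real-linear forms in the preferred chart. Type (2,0) bridges the first gap, holomorphy of transition
maps the second. -/
theorem isHolomorphicBivector_iff (π : BivectorField E M ℂ) :
    IsHolomorphicBivector π ↔ IsTypeTwoZero π ∧ ∀ (x₀ : M) (z : E) (l m : E →L[ℝ] ℂ),
      fderiv ℝ (bivectorInChart π x₀) (chartAt E x₀ x₀) (mulI E z) l m
        = Complex.I * fderiv ℝ (bivectorInChart π x₀) (chartAt E x₀ x₀) z l m := by
  refine and_congr_right fun hπ => ⟨fun h x₀ z l m => ?_, fun h e he l m x₁ hx₁ => ?_⟩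
  · obtain ⟨l', hl⟩ := exists_restrictScalars_eq l
    obtain ⟨m', hm⟩ := exists_restrictScalars_eq m
    have h1 := (h _ (chart_mem_atlas E x₀) l' m' x₀ (mem_chart_source E x₀)).mdifferentiableAt
      ((chartAt E x₀).open_source.mem_nhds (mem_chart_source E x₀))
    have h2 : DifferentiableAt ℂ (fun y => bivectorInChart π x₀ y (l'.restrictScalars ℝ)
      (m'.restrictScalars ℝ)) (chartAt E x₀ x₀) := mdifferentiableAt_iff_comp_chartAt_symm.1 h1
    have h3 := (differentiableAt_complex_iff.1 h2).2 z
    rw [(hasFDerivAt_bivectorInChart π x₀ _ _).fderiv, hl, hm] at h3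
    have hA := isComplexAlternating_fderiv_bivectorInChart π x₀
    have hT := hπ.fderiv_bivectorInChart x₀
    -- The derivative again has type (2,0), so its values on arbitrary forms are determined by those
    -- on complex linear ones.
    rw [(hA _).apply_eq_complexLinear (hT _), (hA z).apply_eq_complexLinear (hT z)]
    refine (congrArg (1 / 4 * ·) h3).trans ?_
    simp only [derivPairing_apply, smul_eq_mul]
    ring
  · refine MDifferentiableAt.mdifferentiableWithinAt ?_
    rw [mdifferentiableAt_iff_comp_chartAt_symm]
    have hs := (chartAt E x₁).left_inv (mem_chart_source E x₁)
    have hG := (contDiffAt_comp_chartAt_symm he x₁ (mem_chart_target E x₁) (by rwa [hs]))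
    have hG' := (hG.fderiv_right (m := 1) (by simp)).differentiableAt (by simp)
    -- Read in the preferred chart at `x₁`, the coordinate forms of `e` have coefficients given by
    -- the derivative of the transition map. These are holomorphic in `y`, so the product rule gives
    -- the Cauchy–Riemann equation for the coefficient of `π`.
    let G : E → E →L[ℂ] E := fderiv ℂ (e ∘ (chartAt E x₁).symm)
    have hp : ∀ k : E →L[ℂ] ℂ, DifferentiableAt ℂ
        (fun y => (k.comp (G y)).restrictScalars ℝ) (chartAt E x₁ x₁) := fun k =>
      (ContinuousLinearMap.restrictScalarsL ℂ E ℂ ℝ ℂ).differentiableAt.comp _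
        ((differentiableAt_const k).clm_comp hG')
    have hev : (fun x => π.toFun x ((l.restrictScalars ℝ).comp (chartDifferential e x))
          ((m.restrictScalars ℝ).comp (chartDifferential e x))) ∘ (chartAt E x₁).symm
        =ᶠ[𝓝 (chartAt E x₁ x₁)] fun y => bivectorInChart π x₁ y
          ((l.comp (G y)).restrictScalars ℝ) ((m.comp (G y)).restrictScalars ℝ) := by
      have h1 : ∀ᶠ y in 𝓝 (chartAt E x₁ x₁), (chartAt E x₁).symm y ∈ e.source :=
        ((chartAt E x₁).continuousAt_symm (mem_chart_target E x₁)).eventually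
          (by rw [hs]; exact e.open_source.mem_nhds hx₁)
      filter_upwards [chart_target_mem_nhds x₁, h1] with y hy hy'
      simp only [Function.comp_apply]
      rw [chartDifferential_chartAt_symm he x₁ hy hy']
      rfl
    refine DifferentiableAt.congr_of_eventuallyEq ?_ hev
    rw [differentiableAt_complex_iff]
    have hB := ((contDiffAt_bivectorInChart π x₁).differentiableAt (by simp)).hasFDerivAt
    obtain ⟨hl, hl'⟩ := differentiableAt_complex_iff.1 (hp l)
    obtain ⟨hm, hm'⟩ := differentiableAt_complex_iff.1 (hp m)
    have hD := (hB.clm_apply hl.hasFDerivAt).clm_apply hm.hasFDerivAt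
    refine ⟨hD.differentiableAt, fun z => ?_⟩
    rw [hD.fderiv]
    have hA := isComplexAlternating_bivectorInChart π x₁ (chartAt E x₁ x₁)
    have hz := h x₁ z
    simp only [mulI_apply] at hz
    simp [hl', hm', hz, hA.smul_left, hA.smul_right]
    ring

theorem IsHolomorphicBivector.holomorphicJet {π : BivectorField E M ℂ}
    (h : IsHolomorphicBivector π) (x₀ : M) :
    HolomorphicJet (bivectorInChart π x₀ (chartAt E x₀ x₀))
      (fderiv ℝ (bivectorInChart π x₀) (chartAt E x₀ x₀)) where
  alternating := isComplexAlternating_bivectorInChart π x₀ _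
  alternating' := isComplexAlternating_fderiv_bivectorInChart π x₀
  type := (isTypeTwoZero_iff π).1 h.1 x₀
  type' := h.1.fderiv_bivectorInChart x₀
  holomorphic := ((isHolomorphicBivector_iff π).1 h).2 x₀

/-- On real covectors the jet condition for `π_I` is the imaginary part of the Cauchy–Riemann
equation for `π`. Its real part is the same condition at `J z`, and complex bilinearity does the
rest. -/
theorem IsTypeTwoZero.isHolomorphicBivector_iff {π : BivectorField E M ℂ}
    (h : IsTypeTwoZero π) : IsHolomorphicBivector π ↔ ∀ x₀ : M,
      JetHolomorphic (mulI E) (fderiv ℝ (sharpInChart π.im x₀) (chartAt E x₀ x₀)) := by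
  rw [HolPoisson.isHolomorphicBivector_iff, and_iff_right h]
  refine forall_congr' fun x₀ => ?_
  have hA := isComplexAlternating_fderiv_bivectorInChart π x₀
  have hT := h.fderiv_bivectorInChart x₀
  have key : JetHolomorphic (mulI E) (fderiv ℝ (sharpInChart π.im x₀) (chartAt E x₀ x₀)) ↔
      ∀ z (a b : E →L[ℝ] ℝ),
        (fderiv ℝ (HolPoisson.bivectorInChart π x₀) (chartAt E x₀ x₀) (mulI E z) (complexify a)
          (complexify b)).im
        = (fderiv ℝ (HolPoisson.bivectorInChart π x₀) (chartAt E x₀ x₀) z (complexify a)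
          (complexify b)).re := by
    refine forall_congr' fun z => forall_congr' fun a => ?_
    rw [SeparatingDual.eq_iff_forall_dual_eq (R := ℝ)]
    refine forall_congr' fun b => ?_
    rw [apply_fderiv_sharpInChart, fderiv_bivectorInChart_im,
      ← ContinuousLinearMap.comp_apply b (mulI E), apply_fderiv_sharpInChart,
      fderiv_bivectorInChart_im, ← complexify_comp, (hA z).comp_right (hT z)]
    simp
  rw [key]
  constructor
  · intro H z a b
    rw [H]
    simp
  · intro H z
    refine (hA _).eq_smul (hA z) fun a b => Complex.ext ?_ ?_
    · have h1 := H (mulI E z) a b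
      rw [mulI_mulI, map_neg, neg_apply, neg_apply, Complex.neg_im] at h1
      rw [← h1]
      simp
    · rw [H]
      simp

theorem IsHolomorphicBivector.schoutenSquareZero_iff [T2Space M] {π : BivectorField E M ℂ}
    (h : IsHolomorphicBivector π) : SchoutenSquareZero π ↔ IsPoissonTensor π.im := by
  unfold IsPoissonTensor
  rw [HolPoisson.schoutenSquareZero_iff, HolPoisson.schoutenSquareZero_iff]
  refine forall_congr' fun x₀ => ?_
  exact (h.holomorphicJet x₀).jacobiator_eq_zero_iff_im (bivectorInChart_im π x₀ _)
    (fderiv_bivectorInChart_im π x₀)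

theorem isHolomorphicPoisson_iff [T2Space M] (π : BivectorField E M ℂ) :
    IsHolomorphicPoisson π ↔ IsTypeTwoZero π ∧ ∀ x₀ : M,
      JetHolomorphic (mulI E) (fderiv ℝ (sharpInChart π.im x₀) (chartAt E x₀ x₀)) ∧
      JetPoisson (sharpInChart π.im x₀ (chartAt E x₀ x₀))
        (fderiv ℝ (sharpInChart π.im x₀) (chartAt E x₀ x₀)) := by
  rw [forall_and, ← isPoissonTensor_iff]
  constructor
  · rintro ⟨h, hP⟩
    exact ⟨h.1, h.1.isHolomorphicBivector_iff.1 h, h.schoutenSquareZero_iff.1 hP⟩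
  · rintro ⟨h, hH, hP⟩
    have h' := h.isHolomorphicBivector_iff.2 hH
    exact ⟨h', h'.schoutenSquareZero_iff.2 hP⟩

theorem IsTypeTwoZero.isPoissonNijenhuis_iff [T2Space M] {π : BivectorField E M ℂ}
    (h : IsTypeTwoZero π) : IsPoissonNijenhuis π.im (almostComplex E M) ↔ ∀ x₀ : M,
      JetHolomorphic (mulI E) (fderiv ℝ (sharpInChart π.im x₀) (chartAt E x₀ x₀)) ∧
      JetPoisson (sharpInChart π.im x₀ (chartAt E x₀ x₀))
        (fderiv ℝ (sharpInChart π.im x₀) (chartAt E x₀ x₀)) := by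
  have hJ := constantInCharts_almostComplex (E := E) (M := M)
  rw [forall_and, ← isPoissonTensor_iff, ← hJ.compatible_iff mulI_mulI h.almostComplex_sharp]
  exact ⟨fun H => ⟨H.compat, H.poisson⟩,
    fun H => ⟨H.2, hJ.isNijenhuisTensor mulI_mulI, h.almostComplex_sharp, H.1⟩⟩

end HolomorphicBivectors

end HolPoisson

end

/-! ### The three-way equivalence -/

theorem mainTheorem4 {E : Type*} [NormedAddCommGroup E] [NormedSpace ℂ E] [FiniteDimensional ℂ E]
    {M : Type*} [TopologicalSpace M] [T2Space M] [ChartedSpace E M] [IsManifold 𝓘(ℂ, E) ω M]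
    (π : BivectorField E M ℂ) :
    List.TFAE [
      IsHolomorphicPoisson π,
      IsPoissonNijenhuis π.im (almostComplex E M) ∧
        ∀ (x : M) (α : Cotan (E := E) ℝ x),
          sharp (π.re.toFun x) α = sharp (π.im.toFun x) (α.comp (almostComplex E M x)),
      IsGeneralizedComplex (genMatrix π.im (almostComplex E M)) ∧
        ∀ (x : M) (α : Cotan (E := E) ℝ x),
          sharp (π.re.toFun x) α = sharp (π.im.toFun x) (α.comp (almostComplex E M x))] := by
  -- The relation between `π_R` and `π_I` becomes the type condition in (b) and (c), and (a)
  -- contains it; all comparisons then take place under it, where every condition is the same pair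
  -- of jet conditions.
  rw [← isTypeTwoZero_iff_sharp]
  tfae_have 1 ↔ 2 := by
    rw [isHolomorphicPoisson_iff, and_comm]
    exact and_congr_left fun h => h.isPoissonNijenhuis_iff.symm
  tfae_have 2 ↔ 3 := and_congr_left fun h => h.isPoissonNijenhuis_iff.trans
    (constantInCharts_almostComplex.isGeneralizedComplex_iff mulI_mulI h.almostComplex_sharp).symm
  tfae_finish
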